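/- Conventions. $M$ is a Riemann surface (connected, Hausdorff), $\mathrm{U}(n)$ is the group of unitary operators of $\mathbb C^n$, $k\ge 2$, and $\omega_k=e^{2\pi i/k}$. $\mathcal H_+\subset L^2(S^1,\mathbb C^n)$ is the Hardy space of functions whose Fourier coefficients of negative index vanish. An *extended solution* is a smooth map $\Phi:S^1\times M\to \mathrm U(n)$ with $\Phi(1,\cdot)=I$ such that, for every local complex coordinate $z$ on $M$, there are $\mathfrak{gl}(n,\mathbb C)$-valued maps $A_z,A_{\bar z}$, independent of $\lambda$, with $$\Phi(\lambda,\cdot)^{-1}d\Phi(\lambda,\cdot)=(1-\lambda^{-1})A_z\,dz+(1-\lambda)A_{\bar z}\,d\bar z\qquad(\lambda\in S^1);$$ the family $W(z)=\Phi(\cdot,z)\mathcal H_+$, $z\in M$, is also called an extended solution. $W$ is *$k$-symmetric* if, for every $z\in M$, $f\in W(z)$ implies $f_\omega\in W(z)$, where $f_\omega(\lambda)=f(\omega_k\lambda)$. For integers $s_0,\dots,s_{l-1}\ge 0$ with sum $n$, $F_{s_0,\dots,s_{l-1}}$ is the flag manifold of ordered orthogonal decompositions $\mathbb C^n=A_0\oplus\dots\oplus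 A_{l-1}$ with $\dim A_i=s_i$, with the $\mathrm U(n)$-invariant metric induced by the Killing form of $\mathfrak u(n)$. Given a base point $x_0=(A_0,\dots,A_{l-1})$, put $\mathfrak g^i=\bigoplus_{j\in\mathbb Z_l}\mathrm{Hom}(A_j,A_{j-i})$ for $i\in\mathbb Z_l$. A smooth map $\varphi:M\to F_{s_0,\dots,s_{l-1}}$ is *primitive* if, for every smooth local lift $\psi$ of $\varphi$ (a $\mathrm U(n)$-valued map on an open subset of $M$ with $\varphi=\psi x_0$; such lifts exist near each point) and every local complex coordinate $z$, $\psi^{-1}\partial_z\psi$ takes values in $\mathfrak g^0+\mathfrak g^{-1}$; this does not depend on $x_0$. It is *harmonic* if it is a critical point of the energy $\frac12\int|d\varphi|^2$ for compactly supported smooth variations (it is enough to take variations supported in the domain of a local complex coordinate; the energy depends only on the conformal structure of $M$). A *primitive harmonic map* is a map that is primitive and harmonic. (For $l\ge3$ primitive maps are harmonic, and for $l=2$ all smooth maps are primitive.) **Theorem.** Let $W=\Phi\mathcal H_+$ be a $k$-symmetric extended solution, where $k\ge2$, and let $l\ge1$ be a divisor of $k$. For $0\le j\le k-1$ let $\beta_j=\ker(\Phi(\omega_k,\cdot)-\omega_k^jI)$,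 and for $0\le i\le l-1$ let $$\beta^l_i=\bigoplus_{\substack{0\le j\le k-1\\ j\equiv i \bmod l}}\beta_j .$$ Then the dimensions $s_i=\dim\beta^l_i$ are constant on $M$, and $$\varphi_l=(\beta^l_0,\beta^l_1,\dots,\beta^l_{l-1}):M\to F_{s_0,\dots,s_{l-1}}$$ is a (well-defined) primitive harmonic map. -/

import Mathlib

open scoped Manifold ContDiff
open MeasureTheory

namespace KSymHarmonic

/-- `ℂⁿ` with its standard Hermitian inner product. The definitions below are written for a finite
dimensional complex inner product space `E`, and are used for `E = ℂⁿ`. -/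
abbrev Cn (n : ℕ) : Type := EuclideanSpace ℂ (Fin n)

/-- The linear operators of `E`, that is `𝔤𝔩(n, ℂ)` for `E = ℂⁿ`. The unitary group `U(n)` is
`unitary (Gl E)`, the group of unitary operators, and `star` is the adjoint. -/
abbrev Gl (E : Type*) [NormedAddCommGroup E] [InnerProductSpace ℂ E] : Type _ := E →L[ℂ] E

noncomputable section

/-- The root of unity `ω_k = exp (2πi/k)`, as a point of the unit circle `S¹`. -/
def rootOfUnity (k : ℕ) : Circle := Circle.exp (2 * Real.pi / k)

/-! ### Hardy space and symmetric subspaces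

The circle `S¹` with its normalised arc length measure is represented by `ℝ/ℤ` with Haar measure,
through the isomorphism `x ↦ λ = exp (2πix)`, which is `AddCircle.toCircle`. -/

/-- `L²(S¹, E)`. -/
abbrev L2Circle (E : Type*) [NormedAddCommGroup E] : Type _ :=
  Lp E 2 (AddCircle.haarAddCircle (T := (1 : ℝ)))

theorem integrable_L2Circle {V : Type*} [NormedAddCommGroup V] (f : L2Circle V) :
    Integrable f (AddCircle.haarAddCircle (T := (1 : ℝ))) :=
  (Lp.memLp f).integrable (by norm_num)

/-- The Hardy space `H₊`: the functions in `L²(S¹, E)` whose Fourier coefficients of negative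
index vanish. -/
def hardy (E : Type*) [NormedAddCommGroup E] [InnerProductSpace ℂ E] : Submodule ℂ (L2Circle E) where
  carrier := {f | ∀ m : ℤ, m < 0 → fourierCoeff (f : UnitAddCircle → E) m = 0}
  add_mem' := by
    intro f g hf hg m hm
    rw [fourierCoeff_congr_ae (Lp.coeFn_add f g) ]
    rw [fourierCoeff.add (integrable_L2Circle f) (integrable_L2Circle g), Pi.add_apply,
      hf m hm, hg m hm, add_zero]
  zero_mem' := by
    intro m hm
    rw [fourierCoeff_congr_ae (Lp.coeFn_zero E 2 _)]
    simp [fourierCoeff]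
  smul_mem' := by
    intro c f hf m hm
    rw [fourierCoeff_congr_ae (Lp.coeFn_smul c f)]
    have h := fourierCoeff.const_smul (T := (1 : ℝ)) (f : UnitAddCircle → E) c m
    rw [hf m hm, smul_zero] at h
    exact h

variable {E : Type*} [NormedAddCommGroup E] [InnerProductSpace ℂ E]

/-- The subspace `W = γ H₊` of `L²(S¹, E)`, for an operator valued function `γ` on `S¹`. -/
def mulHardy (γ : Circle → Gl E) : Submodule ℂ (L2Circle E) where
  carrier := {f | ∃ h ∈ hardy E, ∀ᵐ x ∂(AddCircle.haarAddCircle (T := (1 : ℝ))),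
    f x = γ (AddCircle.toCircle x) (h x)}
  add_mem' := by
    rintro f g ⟨h, hh, hf⟩ ⟨h', hh', hg⟩
    refine ⟨h + h', (hardy E).add_mem hh hh', ?_⟩
    filter_upwards [hf, hg, Lp.coeFn_add f g, Lp.coeFn_add h h'] with x h1 h2 h3 h4
    rw [h3, h4, Pi.add_apply, Pi.add_apply, h1, h2, map_add]
  zero_mem' := by
    refine ⟨0, (hardy E).zero_mem, ?_⟩
    filter_upwards [Lp.coeFn_zero E 2 (AddCircle.haarAddCircle (T := (1 : ℝ)))] with x h1
    rw [h1, Pi.zero_apply, map_zero]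
  smul_mem' := by
    rintro c f ⟨h, hh, hf⟩
    refine ⟨c • h, (hardy E).smul_mem c hh, ?_⟩
    filter_upwards [hf, Lp.coeFn_smul c f, Lp.coeFn_smul c h] with x h1 h2 h3
    rw [h2, h3, Pi.smul_apply, Pi.smul_apply, h1, map_smul]

/-- The operator `f ↦ f_ω`, `f_ω (λ) = f (ω λ)`, of `L²(S¹, E)`, for `ω = ω_k`. In the coordinate
`x ∈ ℝ/ℤ` of `S¹`, multiplication of `λ` by `ω_k` is translation of `x` by `1/k`. -/
def rotate (k : ℕ) (f : L2Circle E) : L2Circle E :=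
  Lp.compMeasurePreserving (fun x : UnitAddCircle => ((1 / k : ℝ) : UnitAddCircle) + x)
    (measurePreserving_add_left _ _) f

/-- A subspace `W` of `L²(S¹, E)` is `k`-symmetric if `f ∈ W` implies `f_ω ∈ W`. -/
def IsKSymmetric (k : ℕ) (W : Submodule ℂ (L2Circle E)) : Prop :=
  ∀ f ∈ W, rotate k f ∈ W

/-- Translation by `1/k` on `ℝ/ℤ` is multiplication by `ω_k` on `S¹`. -/
theorem toCircle_translate (k : ℕ) (x : UnitAddCircle) :
    AddCircle.toCircle (((1 / k : ℝ) : UnitAddCircle) + x)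
      = rootOfUnity k * AddCircle.toCircle x := by
  rw [AddCircle.toCircle_add, AddCircle.toCircle_apply_mk, rootOfUnity]
  congr 2
  ring

/-! ### Extended solutions -/

section surface

variable {M : Type*} [TopologicalSpace M] [ChartedSpace ℂ M]

/-- An extended solution: a smooth map `Φ : S¹ × M → U(n)` with `Φ(1, ·) = I` such that in each
local complex coordinate `z` there are `𝔤𝔩(n, ℂ)`-valued `A = A_z`, `B = A_{\bar z}` with
`Φ(λ, ·)⁻¹ dΦ(λ, ·) = (1 - λ⁻¹) A dz + (1 - λ) B d\bar z` for all `λ`.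
(In the last field `w` runs over the coordinate domain, and both sides are evaluated on the
tangent vector `v`, for which `dz v = v` and `d\bar z v = conj v`.) -/
structure IsExtendedSolution [CompleteSpace E] (Φ : Circle → M → Gl E) : Prop where
  mem_unitary : ∀ c z, Φ c z ∈ unitary (Gl E)
  smooth : ContMDiff ((𝓡 1).prod 𝓘(ℝ, ℂ)) 𝓘(ℝ, Gl E) ∞ (fun p : Circle × M => Φ p.1 p.2)
  map_one : ∀ z, Φ 1 z = 1
  maurerCartan : ∀ e ∈ IsManifold.maximalAtlas 𝓘(ℂ) ω M, ∃ A B : ℂ → Gl E,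
    ∀ w ∈ e.target, ∀ c : Circle, ∀ v : ℂ,
      star (Φ c (e.symm w)) * fderiv ℝ (fun u => Φ c (e.symm u)) w v
        = ((1 - (c : ℂ)⁻¹) * v) • A w + ((1 - (c : ℂ)) * (starRingEnd ℂ) v) • B w

/-- The fibre at `z` of the eigenbundle `β_j = ker (Φ(ω_k, ·) - ω_k^j I)`. -/
def eigenBundle (Φ : Circle → M → Gl E) (k j : ℕ) (z : M) : Submodule ℂ E :=
  LinearMap.ker (Φ (rootOfUnity k) z - ((rootOfUnity k : ℂ) ^ j) • (1 : Gl E)).toLinearMap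

/-- The fibre at `z` of `β^l_i`, the sum of the `β_j`, `0 ≤ j ≤ k - 1`, with `j ≡ i` modulo `l`. -/
def sumBundle (Φ : Circle → M → Gl E) (k l : ℕ) (i : ZMod l) (z : M) :
    Submodule ℂ E :=
  ⨆ j : Fin k, ⨆ _ : ((j : ℕ) : ZMod l) = i, eigenBundle Φ k j z

end surface

/-! ### Flag manifolds -/

/-- The flag manifold `F_{s_0, …, s_{l-1}}`: ordered orthogonal decompositions of `E` into
subspaces `A_i` of dimension `s_i`. The index set `{0, …, l-1}` is written as `ℤ/l`. -/
@[ext]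
structure Flag (E : Type*) [NormedAddCommGroup E] [InnerProductSpace ℂ E] (l : ℕ)
    (s : ZMod l → ℕ) where
  space : ZMod l → Submodule ℂ E
  orthogonal : ∀ i j, i ≠ j → space i ⟂ space j
  iSup_eq_top : ⨆ i, space i = ⊤
  finrank_eq : ∀ i, Module.finrank ℂ (space i) = s i

/-- The orthogonal projection onto the `i`-th subspace of a flag. -/
def Flag.proj [FiniteDimensional ℂ E] {l : ℕ} {s : ZMod l → ℕ} (x : Flag E l s) (i : ZMod l) : Gl E :=
  (x.space i).starProjection

/-- For a base point `x₀ = (A_0, …, A_{l-1})`, the subspace `𝔤^i = ⊕_j Hom(A_j, A_{j-i})` of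
`𝔤𝔩(n, ℂ)`, which is the `ω_l^i`-eigenspace of the automorphism `X ↦ s⁻¹ X s`, where `s` is
multiplication by `ω_l^j` on `A_j`. -/
def Flag.grade {l : ℕ} {s : ZMod l → ℕ} (x₀ : Flag E l s) (i : ZMod l) :
    Submodule ℂ (Gl E) where
  carrier := {X | ∀ j, ∀ v ∈ x₀.space j, X v ∈ x₀.space (j - i)}
  add_mem' := fun hX hY j v hv => (x₀.space (j - i)).add_mem (hX j v hv) (hY j v hv)
  zero_mem' := fun j _ _ => (x₀.space (j - i)).zero_mem
  smul_mem' := fun c _ hX j v hv => (x₀.space (j - i)).smul_mem c (hX j v hv)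

/-- The square of the Hilbert-Schmidt norm, `tr (T* T)`. -/
def hsNormSq [CompleteSpace E] (T : Gl E) : ℝ :=
  (LinearMap.trace ℂ E (star T * T).toLinearMap).re

/-- The derivative `∂_z = (∂_x - i ∂_y) / 2` of a function on (an open set of) `ℂ`. -/
def dz (f : ℂ → Gl E) (w : ℂ) : Gl E :=
  (1 / 2 : ℂ) • (fderiv ℝ f w 1 - Complex.I • fderiv ℝ f w Complex.I)

section maps

variable {M : Type*} [TopologicalSpace M] [ChartedSpace ℂ M] {l : ℕ} {s : ZMod l → ℕ}
  [FiniteDimensional ℂ E] [CompleteSpace E]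

/-- Smooth maps into the flag manifold: a flag is identified with the family of the orthogonal
projections onto its subspaces, which embeds the flag manifold as a submanifold of `𝔤𝔩(n, ℂ)^l`. -/
def IsSmooth (φ : M → Flag E l s) : Prop :=
  ∀ i, ContMDiff 𝓘(ℝ, ℂ) 𝓘(ℝ, Gl E) ∞ (fun z => (φ z).proj i)

/-- `ψ` is a (smooth) lift of `φ` on the open set `U`: it takes values in `U(n)`, and `φ = ψ x₀`. -/
structure IsLift (x₀ : Flag E l s) (φ : M → Flag E l s) (U : Set M) (ψ : M → Gl E) : Prop where
  isOpen : IsOpen U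
  smooth : ContMDiffOn 𝓘(ℝ, ℂ) 𝓘(ℝ, Gl E) ∞ ψ U
  mem_unitary : ∀ z ∈ U, ψ z ∈ unitary (Gl E)
  eq_map : ∀ z ∈ U, ∀ i, (φ z).space i = (x₀.space i).map (ψ z).toLinearMap

/-- Primitive maps: `φ` is smooth and, for a base point `x₀` and a lift `ψ` (lifts exist near each
point), `ψ⁻¹ ψ_z` takes values in `𝔤⁰ ⊕ 𝔤⁻¹` for each local complex coordinate `z`. Neither the base
point nor the lift matters, so all of them are taken. -/
def IsPrimitive (φ : M → Flag E l s) : Prop :=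
  IsSmooth φ ∧ ∀ x₀ : Flag E l s,
    (∀ p : M, ∃ (U : Set M) (ψ : M → Gl E), p ∈ U ∧ IsLift x₀ φ U ψ) ∧
    ∀ (U : Set M) (ψ : M → Gl E), IsLift x₀ φ U ψ →
      ∀ e ∈ IsManifold.maximalAtlas 𝓘(ℂ) ω M, ∀ z ∈ U ∩ e.source,
        star (ψ z) * dz (fun w => ψ (e.symm w)) (e z) ∈ x₀.grade 0 ⊔ x₀.grade (-1)

/-- The energy `½ ∫_D |dφ|²` of `φ` on a set `D` inside the domain of the local complex
coordinate `e`. It is computed in the coordinate, as the energy of a map from a surface depends only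
on the conformal structure of the surface. On the flag manifold it uses the `U(n)`-invariant metric
given by the Killing form of `𝔲(n)` (with its sign reversed): if `X ∈ 𝔲(n)` is orthogonal to the
isotropy algebra of a flag with projections `π_i`, then its tangent vector has components
`[X, π_i]`, and `-Kill(X, X) = 2n |X|² = n ∑ |[X, π_i]|²`, where `n = dim E`. -/
def energy [NeZero l] (e : OpenPartialHomeomorph M ℂ) (D : Set M) (φ : M → Flag E l s) : ℝ :=
  (1 / 2) * ∫ w in e '' D, (Module.finrank ℂ E : ℝ) * ∑ i : ZMod l,
    (hsNormSq (fderiv ℝ (fun u => (φ (e.symm u)).proj i) w 1)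
      + hsNormSq (fderiv ℝ (fun u => (φ (e.symm u)).proj i) w Complex.I))

/-- Harmonic maps from a Riemann surface to the flag manifold: smooth maps which are critical points
of the energy, for smooth variations `F` of `φ` through maps to the flag manifold that are supported
in a compact set `K`. As harmonicity is a local condition, `K` may be taken inside
the domain of a local complex coordinate. -/
def IsHarmonic [NeZero l] (φ : M → Flag E l s) : Prop :=
  IsSmooth φ ∧ ∀ e ∈ IsManifold.maximalAtlas 𝓘(ℂ) ω M, ∀ K ⊆ e.source, IsCompact K →
    ∀ F : ℝ → M → Flag E l s,
      (∀ i, ContMDiff (𝓘(ℝ, ℝ).prod 𝓘(ℝ, ℂ)) 𝓘(ℝ, Gl E) ∞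
        (fun p : ℝ × M => (F p.1 p.2).proj i)) →
      F 0 = φ → (∀ t, ∀ z ∉ K, F t z = φ z) →
      HasDerivAt (fun t => energy e K (F t)) 0 0

/-- Primitive harmonic maps. For `l = 2` every smooth map is primitive, and for `l ≥ 3` every
primitive map is harmonic. -/
def IsPrimitiveHarmonic [NeZero l] (φ : M → Flag E l s) : Prop :=
  IsPrimitive φ ∧ IsHarmonic φ

end maps

end

end KSymHarmonic

/-! Fix a point of the surface and write γ for the loop Φ(·, z). By k-symmetry, γ(λ)⁻¹γ(ωλ) has
columns in the Hardy space. Its adjoint is a rotate of γ(λ)⁻¹γ(ω^{k-1}λ), so the same holds for the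
adjoint. Such a loop is constant, and its value at λ = 1 gives γ(ωλ) = γ(λ)γ(ω)
(`map_rootOfUnity_mul`). Hence P = Φ(ω, ·) satisfies P^k = 1, and β^l_i is the ω_l^i-eigenbundle of
R = P^{k/l}, with spectral projection π_i polynomial in R (`iSup_ker_eq_range_specProj`). These
projections are smooth, and their ranks are constant because M is connected.

Comparing Maurer-Cartan forms in Φ(-ω) = Φ(-1)Φ(ω) gives P⁻¹AP = ω⁻¹A and P⁻¹BP = ωB. The equation
for dP then becomes dP = [P, A dz + B d\bar z], which passes to polynomials in P, so dπ_i = [π_i, A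
dz + B d\bar z]. Moreover A raises the index of the decomposition by 1 and B lowers it by 1. Zero
curvature at λ = -1 and λ = i shows that X = A + B and Y = i(A - B) satisfy X_x + Y_y = 0
(`IsExtendedSolution.exists_connection`). These facts are collected in `HasShiftConnection`, and
both conclusions follow from them alone, uniformly in l.

Primitivity: for a lift ψ, ψ⁻¹ψ_z differs from -ψ⁻¹Aψ, which has degree -1, by a term of degree 0
(`HasShiftConnection.star_mul_dz_mem`). Lifts come from a polar decomposition (`exists_isLift`).

Harmonicity: the Laplacian of π_i is [[π_i, X], X] + [[π_i, Y], Y], the divergence term having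
dropped out. It is normal to the flag manifold because the sum of ad(π_i)² acts as a scalar on X and
on Y (`Flag.sum_reTrace_eq_zero`). The first variation of the energy is then the integral of a
compactly supported divergence (`isHarmonic_of_hasShiftConnection`). -/

namespace KSymHarmonic

/-! ### Hardy space: symmetry of W as a multiplicative law for Φ -/

section hardy

open scoped InnerProductSpace

theorem rootOfUnity_pow_self {k : ℕ} (hk : k ≠ 0) : rootOfUnity k ^ k = 1 := by
  rw [rootOfUnity, ← Circle.exp_nsmul, nsmul_eq_mul, mul_div_cancel₀ _ (by exact_mod_cast hk),
    Circle.exp_two_pi]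

theorem fourierCoeff_conj (f : UnitAddCircle → ℂ) (m : ℤ) :
    fourierCoeff (fun x => (starRingEnd ℂ) (f x)) m = (starRingEnd ℂ) (fourierCoeff f (-m)) := by
  simp only [fourierCoeff]
  rw [← integral_conj]
  congr 1
  ext x
  simp

/-- A continuous function such that it and its conjugate have no Fourier coefficients of negative
index is constant. -/
theorem eq_of_fourierCoeff_neg_eq_zero (f : C(UnitAddCircle, ℂ))
    (h1 : ∀ m : ℤ, m < 0 → fourierCoeff f m = 0)
    (h2 : ∀ m : ℤ, m < 0 → fourierCoeff (fun x => (starRingEnd ℂ) (f x)) m = 0)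
    (x y : UnitAddCircle) : f x = f y := by
  have h0 : ∀ m : ℤ, m ≠ 0 → fourierCoeff f m = 0 := by
    intro m hm
    rcases lt_or_gt_of_ne hm with h | h
    · exact h1 m h
    · have := h2 (-m) (by omega)
      rwa [fourierCoeff_conj, neg_neg, map_eq_zero] at this
  have hs : Summable (fourierCoeff f) :=
    summable_of_ne_finset_zero (s := {0}) (fun m hm => h0 m (by simpa using hm))
  have key : ∀ x, f x = fourierCoeff f 0 := by
    intro x
    have hx := has_pointwise_sum_fourier_series_of_summable hs x
    have h3 := hasSum_single (f := fun i => fourierCoeff f i • fourier i x) 0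
      (fun m hm => by simp [h0 m hm])
    rw [hx.unique h3]
    simp
  rw [key x, key y]

theorem fourierCoeff_const_of_ne_zero {V : Type*} [NormedAddCommGroup V] [NormedSpace ℂ V]
    [CompleteSpace V] (v : V) {m : ℤ} (hm : m ≠ 0) :
    fourierCoeff (fun _ : UnitAddCircle => v) m = 0 := by
  have h : fourierCoeff (fourier 0 : C(UnitAddCircle, ℂ)) m = 0 := by
    rw [fourierCoeff_fourier]
    simp [hm]
  simp only [fourierCoeff, fourier_zero, smul_eq_mul, mul_one] at h ⊢
  rw [integral_smul_const, h, zero_smul]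

theorem memLp_of_continuous {V : Type*} [NormedAddCommGroup V] {g : UnitAddCircle → V}
    (hg : Continuous g) :
    MemLp g 2 (AddCircle.haarAddCircle (T := (1 : ℝ))) := by
  have : SecondCountableTopologyEither UnitAddCircle V := inferInstance
  exact hg.memLp_of_hasCompactSupport (HasCompactSupport.of_compactSpace _)

variable {E : Type*} [NormedAddCommGroup E] [InnerProductSpace ℂ E] [CompleteSpace E]

theorem fourierCoeff_inner (v : E) (g : C(UnitAddCircle, E)) (m : ℤ) :
    fourierCoeff (fun x => ⟪v, g x⟫_ℂ) m = ⟪v, fourierCoeff g m⟫_ℂ := by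
  simp only [fourierCoeff]
  rw [← integral_inner]
  · simp [inner_smul_right]
  · exact (by fun_prop : Continuous fun t => fourier (-m) t • g t).integrable_of_hasCompactSupport
      (HasCompactSupport.of_compactSpace _)

theorem star_apply_apply_of_mem_unitary {U : Gl E} (hU : U ∈ unitary (Gl E)) (v : E) :
    (star U) (U v) = v := by
  have := congrArg (fun T : Gl E => T v) (Unitary.star_mul_self_of_mem hU)
  simpa using this

/-- If `γ H₊` is `k`-symmetric then the columns of `γ(λ)⁻¹ γ(ω^j λ)` are in the Hardy space. -/
theorem fourierCoeff_star_mul_rotate {k : ℕ} {γ : Circle → Gl E} (hc : Continuous γ)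
    (hu : ∀ c, γ c ∈ unitary (Gl E)) (hW : IsKSymmetric k (mulHardy γ)) (j : ℕ) (v : E) {m : ℤ}
    (hm : m < 0) :
    fourierCoeff (fun x : UnitAddCircle => (star (γ (AddCircle.toCircle x)))
      (γ (rootOfUnity k ^ j * AddCircle.toCircle x) v)) m = 0 := by
  have hcont : ∀ j : ℕ, Continuous fun x : UnitAddCircle =>
      γ (rootOfUnity k ^ j * AddCircle.toCircle x) v := fun j =>
    (hc.comp (continuous_const.mul AddCircle.continuous_toCircle)).clm_apply continuous_const
  -- The function γv is the image of the constant v, so it lies in W; rotating it j times stays in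
  -- W.
  have hmem : ∀ j : ℕ, (memLp_of_continuous (hcont j)).toLp ∈ mulHardy γ := by
    intro j
    induction j with
    | zero =>
      refine ⟨(memLp_of_continuous (continuous_const (y := v))).toLp, ?_, ?_⟩
      · intro m hm
        rw [fourierCoeff_congr_ae (MemLp.coeFn_toLp _)]
        exact fourierCoeff_const_of_ne_zero v hm.ne
      · filter_upwards [MemLp.coeFn_toLp (memLp_of_continuous (hcont 0)),
          MemLp.coeFn_toLp (memLp_of_continuous (continuous_const (y := v)))] with x h1 h2
        rw [h1, h2, pow_zero, one_mul]
    | succ j ih =>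
      have h := hW _ ih
      rw [rotate, Lp.toLp_compMeasurePreserving] at h
      convert h using 2
      ext x
      simp only [Function.comp, toCircle_translate, pow_succ, mul_assoc]
  obtain ⟨h, hh, hae⟩ := hmem j
  rw [← hh m hm]
  refine congrFun (fourierCoeff_congr_ae ?_) m
  filter_upwards [hae, MemLp.coeFn_toLp (memLp_of_continuous (hcont j))] with x h1 h2
  rw [← h2, h1, star_apply_apply_of_mem_unitary (hu _)]

/-- If `γ H₊` is `k`-symmetric and `γ(1) = 1` then `γ(ω λ) = γ(λ) γ(ω)`. -/
theorem map_rootOfUnity_mul {k : ℕ} (hk : k ≠ 0) {γ : Circle → Gl E} (hc : Continuous γ)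
    (hu : ∀ c, γ c ∈ unitary (Gl E)) (h1 : γ 1 = 1) (hW : IsKSymmetric k (mulHardy γ))
    (c : Circle) : γ (rootOfUnity k * c) = γ c * γ (rootOfUnity k) := by
  have hct : Continuous fun x : UnitAddCircle => γ (AddCircle.toCircle x) :=
    hc.comp AddCircle.continuous_toCircle
  have hcm : ∀ w : Circle, Continuous fun x : UnitAddCircle => γ (w * AddCircle.toCircle x) :=
    fun w => hc.comp (continuous_const.mul AddCircle.continuous_toCircle)
  have hconst : ∀ (u v : E) (x y : UnitAddCircle),
      ⟪u, (star (γ (AddCircle.toCircle x))) (γ (rootOfUnity k * AddCircle.toCircle x) v)⟫_ℂ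
      = ⟪u, (star (γ (AddCircle.toCircle y))) (γ (rootOfUnity k * AddCircle.toCircle y) v)⟫_ℂ := by
    intro u v
    let g (w : Circle) (v : E) : C(UnitAddCircle, E) :=
      ⟨fun x => (star (γ (AddCircle.toCircle x))) (γ (w * AddCircle.toCircle x) v),
        hct.star.clm_apply ((hcm w).clm_apply continuous_const)⟩
    refine eq_of_fourierCoeff_neg_eq_zero ⟨fun x => ⟪u, g (rootOfUnity k) v x⟫_ℂ, by fun_prop⟩ ?_ ?_
    · intro m hm
      have := fourierCoeff_inner u (g (rootOfUnity k) v) m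
      simp only [ContinuousMap.coe_mk] at this ⊢
      rw [this]
      have h2 := fourierCoeff_star_mul_rotate hc hu hW 1 v hm
      simp only [pow_one] at h2
      rw [show fourierCoeff (g (rootOfUnity k) v) m = 0 from h2, inner_zero_right]
    · intro m hm
      let t : UnitAddCircle := ((1 / k : ℝ) : UnitAddCircle)
      -- The conjugate entry is that of γ(ωλ)⁻¹γ(λ). With μ = ωλ and λ = ω^{k-1}μ it is a translate
      -- of an entry of γ(μ)⁻¹γ(ω^{k-1}μ), to which the previous lemma applies with exponent k - 1.
      have h3 : ∀ x, (starRingEnd ℂ) ⟪u, g (rootOfUnity k) v x⟫_ℂ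
          = ⟪v, g (rootOfUnity k ^ (k - 1)) u (t + x)⟫_ℂ := by
        intro x
        rw [inner_conj_symm]
        simp only [g, ContinuousMap.coe_mk, t, toCircle_translate]
        rw [← mul_assoc, ← pow_succ, Nat.sub_add_cancel (Nat.pos_of_ne_zero hk),
          rootOfUnity_pow_self hk, one_mul, ContinuousLinearMap.star_eq_adjoint,
          ContinuousLinearMap.star_eq_adjoint, ContinuousLinearMap.adjoint_inner_left,
          ContinuousLinearMap.adjoint_inner_right]
      simp only [ContinuousMap.coe_mk]
      simp_rw [h3]
      have h4 : fourierCoeff (fun x => ⟪v, g (rootOfUnity k ^ (k - 1)) u x⟫_ℂ) m = 0 := by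
        rw [fourierCoeff_inner]
        rw [show fourierCoeff (g (rootOfUnity k ^ (k - 1)) u) m = 0 from
          fourierCoeff_star_mul_rotate hc hu hW (k - 1) u hm, inner_zero_right]
      simp only [fourierCoeff] at h4 ⊢
      -- Translation by t only multiplies a Fourier coefficient by a character value, so vanishing
      -- is preserved.
      have h5 := integral_add_left_eq_self
        (μ := (AddCircle.haarAddCircle (T := (1 : ℝ))))
        (fun x => fourier (-m) (-t + x) • ⟪v, g (rootOfUnity k ^ (k - 1)) u x⟫_ℂ) t
      simp only [neg_add_cancel_left] at h5
      rw [h5]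
      simp only [smul_eq_mul] at h4 ⊢
      have h6 : ∀ x : UnitAddCircle, fourier (-m) (-t + x) = fourier (-m) (-t) * fourier (-m) x := by
        intro x
        simp [fourier_apply, smul_add, AddCircle.toCircle_add]
      simp_rw [h6, mul_assoc]
      rw [integral_const_mul, h4, mul_zero]
  obtain ⟨x, rfl⟩ : ∃ x : UnitAddCircle, AddCircle.toCircle x = c := by
    obtain ⟨x, hx⟩ := (AddCircle.homeomorphCircle (T := (1 : ℝ)) one_ne_zero).surjective c
    exact ⟨x, by rw [← hx, AddCircle.homeomorphCircle_apply]⟩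
  have h2 : star (γ (AddCircle.toCircle x)) * γ (rootOfUnity k * AddCircle.toCircle x)
      = γ (rootOfUnity k) := by
    ext v
    refine ext_inner_left ℂ fun u => ?_
    -- The point 0 corresponds to λ = 1, where γ = 1.
    have := hconst u v x 0
    simpa [h1] using this
  rw [← h2, ← mul_assoc, Unitary.mul_star_self_of_mem (hu _), one_mul]

end hardy

/-! ### Spectral projections of an operator of finite order -/

section spectral

open ZMod

variable {E : Type*} [NormedAddCommGroup E] [InnerProductSpace ℂ E] {l : ℕ} [NeZero l]

theorem rootOfUnity_pow_div {k : ℕ} (hk : k ≠ 0) (hl : l ∣ k) :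
    rootOfUnity k ^ (k / l) = rootOfUnity l := by
  obtain ⟨d, rfl⟩ := hl
  have hl0 : l ≠ 0 := NeZero.ne l
  have hd : d ≠ 0 := fun h => hk (by simp [h])
  rw [rootOfUnity, rootOfUnity, ← Circle.exp_nsmul,
    Nat.mul_div_cancel_left _ (Nat.pos_of_ne_zero hl0)]
  congr 1
  have h1 : (l : ℝ) ≠ 0 := by exact_mod_cast hl0
  have h2 : (d : ℝ) ≠ 0 := by exact_mod_cast hd
  push_cast
  rw [nsmul_eq_mul]
  field_simp

theorem stdAddChar_natCast (j : ℕ) :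
    stdAddChar ((j : ℕ) : ZMod l) = (rootOfUnity l : ℂ) ^ j := by
  have h := stdAddChar_coe (N := l) (j : ℤ)
  rw [Int.cast_natCast] at h
  rw [h, rootOfUnity, Circle.coe_exp, ← Complex.exp_nat_mul]
  congr 1
  push_cast
  ring

theorem sum_stdAddChar_mul (a : ZMod l) :
    ∑ m : ZMod l, stdAddChar (m * a) = if a = 0 then (l : ℂ) else 0 := by
  rw [AddChar.sum_mulShift _ (isPrimitive_stdAddChar l)]
  simp [ZMod.card]

theorem star_stdAddChar (a : ZMod l) : star (stdAddChar a) = stdAddChar (-a) :=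
  (AddChar.map_neg_eq_conj _ _).symm

/-- The spectral projection of `R`, where `R ^ l = 1`, for the eigenvalue `ω_l ^ i`. -/
noncomputable def specProj (R : Gl E) (i : ZMod l) : Gl E :=
  (l : ℂ)⁻¹ • ∑ m : ZMod l, stdAddChar (-(m * i)) • R ^ m.val

theorem pow_val_add {R : Gl E} (hR : R ^ l = 1) (a b : ZMod l) :
    R ^ (a + b).val = R ^ a.val * R ^ b.val := by
  rw [ZMod.val_add, ← pow_add, ← pow_mod_orderOf, ← pow_mod_orderOf R (a.val + b.val),
    Nat.mod_mod_of_dvd _ (orderOf_dvd_of_pow_eq_one hR)]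

/-- Orthogonality of the characters of ℤ/l. No condition on R is needed, since only its powers on
one eigenvector enter. -/
theorem specProj_apply_of_eigen {R : Gl E} {v : E} {j : ZMod l}
    (hv : R v = stdAddChar j • v) (i : ZMod l) :
    specProj R i v = if i = j then v else 0 := by
  have hpow : ∀ m : ℕ, (R ^ m) v = (stdAddChar j) ^ m • v := by
    intro m
    induction m with
    | zero => simp
    | succ m ih =>
      rw [pow_succ', mul_apply_eq_comp, ih, _root_.map_smul, hv, smul_smul, pow_succ]
  have h1 : ∀ m : ZMod l, (stdAddChar (-(m * i)) • R ^ m.val) v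
      = (stdAddChar (m * (j - i)) : ℂ) • v := by
    intro m
    rw [_root_.smul_apply, hpow, ← AddChar.map_nsmul_eq_pow, smul_smul,
      ← AddChar.map_add_eq_mul, nsmul_eq_mul, ZMod.natCast_zmod_val]
    congr 2
    ring
  rw [specProj, _root_.smul_apply, _root_.sum_apply]
  simp_rw [h1]
  rw [← Finset.sum_smul, sum_stdAddChar_mul]
  have hl0 : (l : ℂ) ≠ 0 := by exact_mod_cast NeZero.ne l
  by_cases h : i = j
  · simp [h, smul_smul, hl0]
  · simp [h, sub_eq_zero, Ne.symm h]

/-- If `R A = ω_l ^ s A R`, then `A` maps the eigenspaces of `R` to each other, with shift `s`. -/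
theorem specProj_mul_of_mul_eq {R A : Gl E} {s : ZMod l} (h : R * A = stdAddChar s • (A * R))
    (i : ZMod l) : specProj R (i + s) * A = A * specProj R i := by
  have hpow : ∀ m : ℕ, R ^ m * A = (stdAddChar s) ^ m • (A * R ^ m) := by
    intro m
    induction m with
    | zero => simp
    | succ m ih =>
      rw [pow_succ', mul_assoc, ih, mul_smul_comm, ← mul_assoc, h, smul_mul_assoc, smul_smul,
        mul_assoc, pow_succ]
  rw [specProj, specProj, smul_mul_assoc, mul_smul_comm, Finset.sum_mul, Finset.mul_sum]
  congr 1
  refine Finset.sum_congr rfl fun m _ => ?_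
  rw [smul_mul_assoc, hpow, smul_smul, mul_smul_comm, ← AddChar.map_nsmul_eq_pow,
    ← AddChar.map_add_eq_mul, nsmul_eq_mul, ZMod.natCast_zmod_val]
  congr 2
  ring

theorem mul_specProj {R : Gl E} (hR : R ^ l = 1) (i : ZMod l) :
    R * specProj R i = stdAddChar i • specProj R i := by
  rw [specProj, mul_smul_comm, smul_comm (stdAddChar i : ℂ) ((l : ℂ)⁻¹)]
  congr 1
  rw [Finset.mul_sum, Finset.smul_sum]
  -- Multiplication by R shifts the summation index by 1.
  rw [← Equiv.sum_comp (Equiv.addLeft (1 : ZMod l))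
    (fun m => (stdAddChar i : ℂ) • (stdAddChar (-(m * i)) : ℂ) • R ^ m.val)]
  refine Finset.sum_congr rfl fun m _ => ?_
  simp only [Equiv.coe_addLeft]
  rw [smul_smul, ← AddChar.map_add_eq_mul, pow_val_add hR, mul_smul_comm]
  congr 1
  · congr 1
    ring
  · congr 1
    -- For l = 1 the representative of 1 in ℤ/l is 0, not 1; then R = 1 by hypothesis.
    rcases Nat.lt_or_ge 1 l with h1 | h1
    · have : Fact (1 < l) := ⟨h1⟩
      rw [ZMod.val_one, pow_one]
    · have : l = 1 := le_antisymm h1 (Nat.pos_of_ne_zero (NeZero.ne l))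
      subst this
      rw [pow_one] at hR
      simp [hR]

theorem sum_specProj (R : Gl E) : ∑ i : ZMod l, specProj R i = 1 := by
  simp only [specProj]
  rw [← Finset.smul_sum, Finset.sum_comm]
  have h1 : ∀ m : ZMod l, ∑ i : ZMod l, (stdAddChar (-(m * i)) : ℂ) • R ^ m.val
      = if m = 0 then (l : ℂ) • (1 : Gl E) else 0 := by
    intro m
    have := sum_stdAddChar_mul (-m)
    rw [← Finset.sum_smul]
    simp_rw [show ∀ i : ZMod l, -(m * i) = i * -m by intro i; ring]
    rw [this]
    by_cases hm : m = 0 <;> simp [hm]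
  simp_rw [h1]
  have hl0 : (l : ℂ) ≠ 0 := by exact_mod_cast NeZero.ne l
  rw [Finset.sum_ite_eq']
  simp [smul_smul, hl0]

theorem specProj_mul_specProj {R : Gl E} (hR : R ^ l = 1) (i j : ZMod l) :
    specProj R i * specProj R j = if i = j then specProj R j else 0 := by
  ext v
  have h : R (specProj R j v) = stdAddChar j • specProj R j v := by
    rw [← mul_apply_eq_comp, mul_specProj hR, _root_.smul_apply]
  rw [mul_apply_eq_comp, specProj_apply_of_eigen h]
  split_ifs <;> simp

theorem mem_range_specProj {R : Gl E} (hR : R ^ l = 1) {i : ZMod l} {v : E} :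
    v ∈ LinearMap.range (specProj R i).toLinearMap ↔ R v = stdAddChar i • v := by
  constructor
  · rintro ⟨w, rfl⟩
    change (R * specProj R i) w = _
    rw [mul_specProj hR]
    rfl
  · intro h
    exact ⟨v, by simpa using specProj_apply_of_eigen h i⟩

theorem star_specProj [CompleteSpace E] {R : Gl E} (hu : R ∈ unitary (Gl E)) (hR : R ^ l = 1)
    (i : ZMod l) : star (specProj R i) = specProj R i := by
  have hs : ∀ m : ZMod l, star (R ^ m.val) = R ^ (-m).val := by
    intro m
    have h1 : R ^ (-m).val * R ^ m.val = 1 := by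
      rw [← pow_val_add hR, neg_add_cancel, ZMod.val_zero, pow_zero]
    have h2 : R ^ m.val * star (R ^ m.val) = 1 :=
      Unitary.mul_star_self_of_mem (pow_mem hu _)
    exact (left_inv_eq_right_inv h1 h2).symm
  rw [specProj, star_smul, star_sum]
  congr 1
  · simp
  · rw [← Equiv.sum_comp (Equiv.neg (ZMod l))]
    refine Finset.sum_congr rfl fun m _ => ?_
    rw [star_smul, star_stdAddChar, hs]
    simp

/-- The sum of the eigenspaces of `P`, `P ^ k = 1`, for the eigenvalues `ω_k ^ j`, `j ≡ i`
modulo `l`, is an eigenspace of `P ^ (k / l)`. -/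
theorem iSup_ker_eq_range_specProj {k : ℕ} (hk : k ≠ 0) (hl : l ∣ k) {P : Gl E} (hP : P ^ k = 1)
    (i : ZMod l) :
    ⨆ j : Fin k, ⨆ _ : ((j : ℕ) : ZMod l) = i,
      LinearMap.ker (P - ((rootOfUnity k : ℂ) ^ (j : ℕ)) • (1 : Gl E)).toLinearMap
    = LinearMap.range (specProj (P ^ (k / l)) i).toLinearMap := by
  have : NeZero k := ⟨hk⟩
  have hR : (P ^ (k / l)) ^ l = 1 := by rw [← pow_mul, Nat.div_mul_cancel hl, hP]
  have hker : ∀ (j : ℕ) (v : E),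
      v ∈ LinearMap.ker (P - ((rootOfUnity k : ℂ) ^ j) • (1 : Gl E)).toLinearMap ↔
        P v = (rootOfUnity k : ℂ) ^ j • v := by
    intro j v
    rw [LinearMap.mem_ker]
    change P v - (rootOfUnity k : ℂ) ^ j • v = 0 ↔ _
    rw [sub_eq_zero]
  have hpow : ∀ (j m : ℕ) (v : E), P v = (rootOfUnity k : ℂ) ^ j • v →
      (P ^ m) v = (rootOfUnity k : ℂ) ^ (j * m) • v := by
    intro j m v hv
    induction m with
    | zero => simp
    | succ m ih =>
      rw [pow_succ', mul_apply_eq_comp, ih, _root_.map_smul, hv, smul_smul, ← pow_add]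
      congr 2
  have hchar : ∀ j : ℕ, (rootOfUnity k : ℂ) ^ (j * (k / l)) = stdAddChar ((j : ℕ) : ZMod l) := by
    intro j
    rw [stdAddChar_natCast, ← rootOfUnity_pow_div hk hl, mul_comm, pow_mul, Circle.coe_pow]
  apply le_antisymm
  · refine iSup_le fun j => iSup_le fun hj => ?_
    intro v hv
    rw [mem_range_specProj hR, hpow j _ v ((hker _ _).1 hv), hchar, hj]
  · intro v hv
    rw [mem_range_specProj hR] at hv
    -- The vector is split into eigenvectors of P itself. Components with j not congruent to i must
    -- vanish: they are eigenvectors of P^{k/l} for ω_l^j, and also for ω_l^i because the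
    -- projections of P commute with P^{k/l}.
    have hsum : v = ∑ j : ZMod k, specProj P j v := by
      rw [← _root_.sum_apply, sum_specProj]
      rfl
    rw [hsum]
    refine Submodule.sum_mem _ fun j _ => ?_
    have hPj : P (specProj P j v) = (rootOfUnity k : ℂ) ^ j.val • specProj P j v := by
      have := (mem_range_specProj hP (i := j)).1 ⟨v, rfl⟩
      rw [← stdAddChar_natCast, ZMod.natCast_zmod_val]
      exact this
    by_cases hj : ((j.val : ℕ) : ZMod l) = i
    · exact Submodule.mem_iSup_of_mem ⟨j.val, ZMod.val_lt j⟩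
        (Submodule.mem_iSup_of_mem hj ((hker _ _).2 hPj))
    · have h1 := hpow _ (k / l) _ hPj
      rw [hchar] at h1
      have hcomm : P ^ (k / l) * specProj P j = specProj P j * P ^ (k / l) := by
        have := specProj_mul_of_mul_eq (R := P) (A := P ^ (k / l)) (s := (0 : ZMod k))
          (by rw [AddChar.map_zero_eq_one, one_smul, ← pow_succ, ← pow_succ']) j
        rw [add_zero] at this
        exact this.symm
      have h2 : (P ^ (k / l)) (specProj P j v) = stdAddChar i • specProj P j v := by
        rw [← mul_apply_eq_comp, hcomm, mul_apply_eq_comp, hv, _root_.map_smul]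
      have h3 := specProj_apply_of_eigen h1 i
      have h4 := specProj_apply_of_eigen h2 i
      rw [if_pos rfl] at h4
      rw [if_neg (Ne.symm hj), h4] at h3
      rw [h3]
      exact Submodule.zero_mem _

end spectral

/-! ### Flags as complete systems of orthogonal projections -/

section flag

variable {E : Type*} [NormedAddCommGroup E] [InnerProductSpace ℂ E] [FiniteDimensional ℂ E]
  {l : ℕ} {s : ZMod l → ℕ}

theorem Flag.proj_apply_eq_self_iff (x : Flag E l s) (i : ZMod l) {v : E} :
    x.proj i v = v ↔ v ∈ x.space i :=
  Submodule.starProjection_eq_self_iff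

theorem Flag.proj_apply_mem (x : Flag E l s) (i : ZMod l) (v : E) : x.proj i v ∈ x.space i :=
  Submodule.starProjection_apply_mem _ _

theorem Flag.star_proj [CompleteSpace E] (x : Flag E l s) (i : ZMod l) :
    star (x.proj i) = x.proj i :=
  isSelfAdjoint_starProjection _

theorem Flag.proj_apply_of_mem (x : Flag E l s) {i j : ZMod l} {v : E} (hv : v ∈ x.space j) :
    x.proj i v = if i = j then v else 0 := by
  split_ifs with h
  · subst h
    exact (x.proj_apply_eq_self_iff i).2 hv
  · rw [Flag.proj, Submodule.starProjection_apply_eq_zero_iff]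
    exact (x.orthogonal j i (Ne.symm h)) hv

theorem Flag.proj_mul_proj (x : Flag E l s) (i j : ZMod l) :
    x.proj i * x.proj j = if i = j then x.proj j else 0 := by
  ext v
  rw [mul_apply_eq_comp, x.proj_apply_of_mem (x.proj_apply_mem j v)]
  split_ifs <;> rfl

theorem Flag.sum_proj [NeZero l] (x : Flag E l s) : ∑ i, x.proj i = 1 := by
  ext v
  have hv : v ∈ ⨆ i, x.space i := by rw [x.iSup_eq_top]; trivial
  refine Submodule.iSup_induction x.space
    (motive := fun v => (∑ i, x.proj i) v = (1 : Gl E) v) hv (fun j v hv => ?_) (by simp)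
    (fun v w hv hw => by rw [map_add, hv, hw, map_add])
  · rw [_root_.sum_apply]
    simp_rw [x.proj_apply_of_mem hv]
    simp

theorem starProjection_range_of_star_eq [CompleteSpace E] {p : Gl E} (hp : p * p = p)
    (hs : star p = p) : (LinearMap.range p.toLinearMap).starProjection = p := by
  ext v
  refine Submodule.eq_starProjection_of_mem_of_inner_eq_zero ⟨v, rfl⟩ ?_
  rintro _ ⟨w, rfl⟩
  change inner ℂ _ (p w) = 0
  rw [← ContinuousLinearMap.adjoint_inner_left, ← ContinuousLinearMap.star_eq_adjoint, hs,
    map_sub, ← mul_apply_eq_comp, hp, sub_self, inner_zero_left]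

/-- The flag of the ranges of a complete system of orthogonal projections. -/
def flagOfProj [CompleteSpace E] [NeZero l] (p : ZMod l → Gl E) (hs : ∀ i, star (p i) = p i)
    (hm : ∀ i j, p i * p j = if i = j then p j else 0) (h1 : ∑ i, p i = 1)
    (hr : ∀ i, Module.finrank ℂ (LinearMap.range (p i).toLinearMap) = s i) : Flag E l s where
  space i := LinearMap.range (p i).toLinearMap
  orthogonal i j hij := by
    rw [Submodule.isOrtho_iff_inner_eq]
    rintro _ ⟨v, rfl⟩ _ ⟨w, rfl⟩
    change inner ℂ (p i v) (p j w) = 0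
    rw [← hs i, ContinuousLinearMap.star_eq_adjoint, ContinuousLinearMap.adjoint_inner_left,
      ← mul_apply_eq_comp, hm, if_neg hij]
    simp
  iSup_eq_top := by
    rw [eq_top_iff]
    intro v _
    have : v = ∑ i, p i v := by rw [← _root_.sum_apply, h1]; rfl
    rw [this]
    exact Submodule.sum_mem _ fun i _ => Submodule.mem_iSup_of_mem i ⟨v, rfl⟩
  finrank_eq := hr

theorem proj_flagOfProj [CompleteSpace E] [NeZero l] (p : ZMod l → Gl E)
    (hs : ∀ i, star (p i) = p i)
    (hm : ∀ i j, p i * p j = if i = j then p j else 0) (h1 : ∑ i, p i = 1)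
    (hr : ∀ i, Module.finrank ℂ (LinearMap.range (p i).toLinearMap) = s i) (i : ZMod l) :
    (flagOfProj p hs hm h1 hr).proj i = p i :=
  starProjection_range_of_star_eq (by rw [hm, if_pos rfl]) (hs i)

end flag

/-! ### Holomorphic charts as real smooth charts -/

section charts

variable {M : Type*} [TopologicalSpace M] [ChartedSpace ℂ M]

theorem contDiffGroupoid_complex_le_real :
    contDiffGroupoid ω 𝓘(ℂ) ≤ contDiffGroupoid ∞ 𝓘(ℝ, ℂ) := by
  refine groupoid_of_pregroupoid_le _ _ fun f s h => ?_
  have h1 : ContDiffOn ℂ ω f s := by simpa [contDiffPregroupoid] using h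
  simpa [contDiffPregroupoid] using (h1.restrict_scalars ℝ).of_le le_top

theorem isManifold_real [IsManifold 𝓘(ℂ) ω M] : IsManifold 𝓘(ℝ, ℂ) ∞ M :=
  { hasGroupoid_of_le (inferInstance : HasGroupoid M (contDiffGroupoid ω 𝓘(ℂ)))
      contDiffGroupoid_complex_le_real with }

theorem mem_maximalAtlas_real {e : OpenPartialHomeomorph M ℂ}
    (he : e ∈ IsManifold.maximalAtlas 𝓘(ℂ) ω M) : e ∈ IsManifold.maximalAtlas 𝓘(ℝ, ℂ) ∞ M :=
  StructureGroupoid.maximalAtlas_mono contDiffGroupoid_complex_le_real he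

variable [IsManifold 𝓘(ℂ) ω M] {F : Type*} [NormedAddCommGroup F] [NormedSpace ℝ F]

theorem contMDiffOn_real_symm {e : OpenPartialHomeomorph M ℂ}
    (he : e ∈ IsManifold.maximalAtlas 𝓘(ℂ) ω M) :
    ContMDiffOn 𝓘(ℝ, ℂ) 𝓘(ℝ, ℂ) ∞ e.symm e.target := by
  have := isManifold_real (M := M)
  exact contMDiffOn_symm_of_mem_maximalAtlas (mem_maximalAtlas_real he)

theorem contDiffOn_comp_symm {e : OpenPartialHomeomorph M ℂ}
    (he : e ∈ IsManifold.maximalAtlas 𝓘(ℂ) ω M) {f : M → F}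
    (hf : ContMDiff 𝓘(ℝ, ℂ) 𝓘(ℝ, F) ∞ f) : ContDiffOn ℝ ∞ (fun w => f (e.symm w)) e.target :=
  (hf.comp_contMDiffOn (contMDiffOn_real_symm he)).contDiffOn

theorem contDiffOn_comp_prod_symm {e : OpenPartialHomeomorph M ℂ}
    (he : e ∈ IsManifold.maximalAtlas 𝓘(ℂ) ω M) {f : ℝ × M → F}
    (hf : ContMDiff (𝓘(ℝ, ℝ).prod 𝓘(ℝ, ℂ)) 𝓘(ℝ, F) ∞ f) :
    ContDiffOn ℝ ∞ (fun p : ℝ × ℂ => f (p.1, e.symm p.2)) (Set.univ ×ˢ e.target) := by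
  have h1 : ContMDiffOn 𝓘(ℝ, ℝ × ℂ) 𝓘(ℝ, ℂ) ∞ (fun p : ℝ × ℂ => e.symm p.2)
      (Set.univ ×ˢ e.target) :=
    (contMDiffOn_real_symm he).comp contDiff_snd.contMDiff.contMDiffOn (fun p hp => hp.2)
  have h2 : ContMDiffOn 𝓘(ℝ, ℝ × ℂ) 𝓘(ℝ, ℝ) ∞ (fun p : ℝ × ℂ => p.1)
      (Set.univ ×ˢ e.target) := contDiff_fst.contMDiff.contMDiffOn
  exact (hf.comp_contMDiffOn (h2.prodMk h1)).contDiffOn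

end charts

/-! ### Differential calculus of operator-valued functions -/

section calculus

theorem fderiv_fderiv_comm {V F : Type*} [NormedAddCommGroup V] [NormedSpace ℝ V]
    [NormedAddCommGroup F] [NormedSpace ℝ F] {f : V → F} {s : Set V} (hs : IsOpen s)
    (hf : ContDiffOn ℝ ∞ f s) {x : V} (hx : x ∈ s) (u v : V) :
    fderiv ℝ (fun y => fderiv ℝ f y u) x v = fderiv ℝ (fun y => fderiv ℝ f y v) x u := by
  have hfx : ContDiffAt ℝ ∞ f x := hf.contDiffAt (hs.mem_nhds hx)
  have hd : DifferentiableAt ℝ (fderiv ℝ f) x :=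
    (hfx.fderiv_right (m := 1) (by norm_cast)).differentiableAt (by norm_num)
  rw [fderiv_clm_apply hd (differentiableAt_const _), fderiv_clm_apply hd (differentiableAt_const _)]
  simpa using (hfx.isSymmSndFDerivAt (by
    rw [minSmoothness_of_isRCLikeNormedField]
    exact WithTop.coe_le_coe.2 le_top)).eq v u

variable {E : Type*} [NormedAddCommGroup E] [InnerProductSpace ℂ E]

theorem contDiff_star [CompleteSpace E] : ContDiff ℝ ∞ (star : Gl E → Gl E) :=
  (starL' ℝ : Gl E ≃L[ℝ] Gl E).contDiff

/-- The directional derivatives of `f` at `w` are the commutators with `X v`. -/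
def IsCommDeriv (f : ℂ → Gl E) (w : ℂ) (X : ℂ → Gl E) : Prop :=
  DifferentiableAt ℝ f w ∧ ∀ v, fderiv ℝ f w v = f w * X v - X v * f w

/-- The commutator with a fixed operator is a derivation, so the equation passes to powers, and then
to the polynomial expressions defining the spectral projections. -/
theorem IsCommDeriv.pow {f : ℂ → Gl E} {w : ℂ} {X : ℂ → Gl E} (h : IsCommDeriv f w X) (m : ℕ) :
    IsCommDeriv (fun u => f u ^ m) w X := by
  induction m with
  | zero => simp [IsCommDeriv]
  | succ m ih =>
    obtain ⟨h1, h2⟩ := h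
    obtain ⟨h3, h4⟩ := ih
    refine ⟨h1.pow _, fun v => ?_⟩
    simp_rw [pow_succ]
    have h5 := (h3.hasFDerivAt.mul' h1.hasFDerivAt).fderiv
    rw [show (fun u => f u ^ m * f u) = (fun u => f u ^ m) * f from rfl, h5]
    simp only [_root_.add_apply, _root_.smul_apply, smul_eq_mul, h2, h4,
      MulOpposite.smul_eq_mul_unop, MulOpposite.unop_op]
    noncomm_ring

theorem IsCommDeriv.const_smul {f : ℂ → Gl E} {w : ℂ} {X : ℂ → Gl E} (h : IsCommDeriv f w X)
    (c : ℂ) : IsCommDeriv (fun u => c • f u) w X := by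
  refine ⟨h.1.const_smul c, fun v => ?_⟩
  rw [show (fun u => c • f u) = c • f from rfl, fderiv_const_smul h.1]
  rw [_root_.smul_apply, h.2, smul_sub, Pi.smul_apply, smul_mul_assoc, mul_smul_comm]

theorem IsCommDeriv.sum {ι : Type*} (s : Finset ι) {f : ι → ℂ → Gl E} {w : ℂ} {X : ℂ → Gl E}
    (h : ∀ i, IsCommDeriv (f i) w X) : IsCommDeriv (fun u => ∑ i ∈ s, f i u) w X := by
  refine ⟨DifferentiableAt.fun_sum fun i _ => (h i).1, fun v => ?_⟩
  rw [fderiv_fun_sum fun i _ => (h i).1, _root_.sum_apply, Finset.sum_mul, Finset.mul_sum,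
    ← Finset.sum_sub_distrib]
  exact Finset.sum_congr rfl fun i _ => (h i).2 v

theorem IsCommDeriv.specProj {l : ℕ} [NeZero l] {f : ℂ → Gl E} {w : ℂ} {X : ℂ → Gl E}
    (h : IsCommDeriv f w X) (i : ZMod l) : IsCommDeriv (fun u => specProj (f u) i) w X :=
  (IsCommDeriv.sum _ fun _ => (h.pow _).const_smul _).const_smul _

theorem fderiv_mul_apply {V : Type*} [NormedAddCommGroup V] [NormedSpace ℝ V] {f g : V → Gl E}
    {w : V} (hf : DifferentiableAt ℝ f w) (hg : DifferentiableAt ℝ g w) (v : V) :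
    fderiv ℝ (fun u => f u * g u) w v = fderiv ℝ f w v * g w + f w * fderiv ℝ g w v := by
  rw [show (fun u => f u * g u) = f * g from rfl, (hf.hasFDerivAt.mul' hg.hasFDerivAt).fderiv]
  simp only [_root_.add_apply, _root_.smul_apply, smul_eq_mul,
      MulOpposite.smul_eq_mul_unop, MulOpposite.unop_op]
  rw [add_comm]

/-- The zero curvature equation for `f⁻¹ df = a dx + b dy`. -/
theorem zero_curvature [CompleteSpace E] {f a b : ℂ → Gl E} {T : Set ℂ} (hT : IsOpen T)
    (hf : ContDiffOn ℝ ∞ f T) (hu : ∀ w ∈ T, f w ∈ unitary (Gl E)) {u v : ℂ}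
    (ha : ∀ w ∈ T, fderiv ℝ f w u = f w * a w) (hb : ∀ w ∈ T, fderiv ℝ f w v = f w * b w) :
    ContDiffOn ℝ ∞ a T ∧ ContDiffOn ℝ ∞ b T ∧ ∀ w ∈ T,
      fderiv ℝ a w v - fderiv ℝ b w u = a w * b w - b w * a w := by
  -- Smoothness of the Maurer-Cartan coefficients is derived from f* ∂f, as an extended solution
  -- carries no regularity assumption on A and B.
  have hsm : ∀ (a : ℂ → Gl E) (u : ℂ), (∀ w ∈ T, fderiv ℝ f w u = f w * a w) →
      ContDiffOn ℝ ∞ a T := by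
    intro a u ha
    have h1 : ContDiffOn ℝ ∞ (fun w => star (f w) * fderiv ℝ f w u) T :=
      (contDiff_star.comp_contDiffOn hf).mul
        ((hf.fderiv_of_isOpen hT (by norm_cast)).clm_apply contDiffOn_const)
    refine h1.congr fun w hw => ?_
    rw [ha w hw, ← mul_assoc, Unitary.star_mul_self_of_mem (hu w hw), one_mul]
  have hsa := hsm a u ha
  have hsb := hsm b v hb
  refine ⟨hsa, hsb, fun w hw => ?_⟩
  have hdiff : ∀ {g : ℂ → Gl E}, ContDiffOn ℝ ∞ g T → DifferentiableAt ℝ g w := fun hg =>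
    (hg.contDiffAt (hT.mem_nhds hw)).differentiableAt (by simp)
  have hsym := fderiv_fderiv_comm hT hf hw u v
  have e1 : fderiv ℝ (fun y => fderiv ℝ f y u) w = fderiv ℝ (fun y => f y * a y) w :=
    Filter.EventuallyEq.fderiv_eq (by filter_upwards [hT.mem_nhds hw] with y hy using ha y hy)
  have e2 : fderiv ℝ (fun y => fderiv ℝ f y v) w = fderiv ℝ (fun y => f y * b y) w :=
    Filter.EventuallyEq.fderiv_eq (by filter_upwards [hT.mem_nhds hw] with y hy using hb y hy)
  rw [e1, e2, fderiv_mul_apply (hdiff hf) (hdiff hsa), fderiv_mul_apply (hdiff hf) (hdiff hsb),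
    ha w hw, hb w hw] at hsym
  have h2 : f w * (fderiv ℝ a w v - fderiv ℝ b w u) = f w * (a w * b w - b w * a w) := by
    rw [mul_sub, mul_sub, ← mul_assoc, ← mul_assoc, sub_eq_sub_iff_add_eq_add, add_comm, hsym,
      add_comm]
  have h3 := congrArg (fun x => star (f w) * x) h2
  simpa only [← mul_assoc, Unitary.star_mul_self_of_mem (hu w hw), one_mul] using h3

end calculus

/-! ### The connection form of a symmetric extended solution -/

section connection

variable {M : Type*} [TopologicalSpace M] [ChartedSpace ℂ M]
  {E : Type*} [NormedAddCommGroup E] [InnerProductSpace ℂ E] [CompleteSpace E]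

theorem IsExtendedSolution.contMDiff {Φ : Circle → M → Gl E} (hΦ : IsExtendedSolution Φ)
    (c : Circle) : ContMDiff 𝓘(ℝ, ℂ) 𝓘(ℝ, Gl E) ∞ (Φ c) :=
  hΦ.smooth.comp (contMDiff_const.prodMk contMDiff_id)

theorem IsExtendedSolution.continuous {Φ : Circle → M → Gl E} (hΦ : IsExtendedSolution Φ)
    (z : M) : Continuous fun c => Φ c z :=
  hΦ.smooth.continuous.comp (by fun_prop : Continuous fun c : Circle => (c, z))

/-- The eigenvalue equations satisfied by the Maurer-Cartan form of an extended solution with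
`Φ(ω λ) = Φ(λ) Φ(ω)`, and the first order equation for `P = Φ(ω)`. The harmonicity of `Φ(-1)` is
the vanishing of the divergence of `(A + B, i (A - B))`. -/
theorem IsExtendedSolution.exists_connection [IsManifold 𝓘(ℂ) ω M] {Φ : Circle → M → Gl E}
    (hΦ : IsExtendedSolution Φ) {o : Circle} (ho : ∀ c z, Φ (o * c) z = Φ c z * Φ o z)
    {e : OpenPartialHomeomorph M ℂ} (he : e ∈ IsManifold.maximalAtlas 𝓘(ℂ) ω M) :
    ∃ A B : ℂ → Gl E,
      ContDiffOn ℝ ∞ (fun w => A w + B w) e.target ∧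
      ContDiffOn ℝ ∞ (fun w => Complex.I • (A w - B w)) e.target ∧
      (∀ w ∈ e.target, fderiv ℝ (fun w => A w + B w) w 1
        + fderiv ℝ (fun w => Complex.I • (A w - B w)) w Complex.I = 0) ∧
      (∀ w ∈ e.target, Φ o (e.symm w) * A w = (o : ℂ) • (A w * Φ o (e.symm w))) ∧
      (∀ w ∈ e.target, Φ o (e.symm w) * B w = (o : ℂ)⁻¹ • (B w * Φ o (e.symm w))) ∧
      ∀ w ∈ e.target, IsCommDeriv (fun u => Φ o (e.symm u)) w
        (fun v => v • A w + (starRingEnd ℂ) v • B w) := by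
  obtain ⟨A, B, hAB⟩ := hΦ.maurerCartan e he
  have hT := e.open_target
  have hsm : ∀ c, ContDiffOn ℝ ∞ (fun w => Φ c (e.symm w)) e.target := fun c =>
    contDiffOn_comp_symm he (hΦ.contMDiff c)
  have hu : ∀ c, ∀ w ∈ e.target, Φ c (e.symm w) ∈ unitary (Gl E) := fun c w _ =>
    hΦ.mem_unitary c _
  have hd : ∀ c, ∀ w ∈ e.target, ∀ v : ℂ, fderiv ℝ (fun u => Φ c (e.symm u)) w v
      = Φ c (e.symm w) * (((1 - (c : ℂ)⁻¹) * v) • A w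
        + ((1 - (c : ℂ)) * (starRingEnd ℂ) v) • B w) := by
    intro c w hw v
    rw [← hAB w hw c v, ← mul_assoc, Unitary.mul_star_self_of_mem (hu c w hw), one_mul]
  have hdiff : ∀ c, ∀ w ∈ e.target, DifferentiableAt ℝ (fun w => Φ c (e.symm w)) w :=
    fun c w hw => ((hsm c).contDiffAt (hT.mem_nhds hw)).differentiableAt (by simp)
  -- Two values of λ suffice: at -1 the coefficients of A and B are both 2, at i they are 1 + i and
  -- 1 - i. In the directions 1 and i the form is (2X, 2Y) at -1 and (X + Y, Y - X) at i.
  let m1 : Circle := Circle.exp Real.pi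
  let mi : Circle := Circle.exp (Real.pi / 2)
  have hm1 : (m1 : ℂ) = -1 := by simp [m1, Circle.coe_exp]
  have hmi : (mi : ℂ) = Complex.I := by
    simp only [mi, Circle.coe_exp]
    push_cast
    exact Complex.exp_pi_div_two_mul_I
  set X : ℂ → Gl E := fun w => A w + B w with hX
  set Y : ℂ → Gl E := fun w => Complex.I • (A w - B w) with hY
  have z1 := zero_curvature hT (hsm m1) (hu m1) (u := 1) (v := Complex.I)
    (a := fun w => (2 : ℂ) • X w) (b := fun w => (2 : ℂ) • Y w)
    (fun w hw => by
      rw [hd m1 w hw, hm1]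
      simp only [hX]
      congr 1
      norm_num)
    (fun w hw => by
      rw [hd m1 w hw, hm1]
      simp only [hY, Complex.conj_I]
      congr 1
      norm_num
      module)
  have z2 := zero_curvature hT (hsm mi) (hu mi) (u := 1) (v := Complex.I)
    (a := fun w => X w + Y w) (b := fun w => Y w - X w)
    (fun w hw => by
      rw [hd mi w hw, hmi]
      simp only [hX, hY, Complex.inv_I]
      congr 1
      simp only [_root_.map_one]
      module)
    (fun w hw => by
      rw [hd mi w hw, hmi]
      simp only [hX, hY, Complex.conj_I, Complex.inv_I]
      congr 1
      have h2 : (1 - -Complex.I) * Complex.I = Complex.I - 1 := by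
        linear_combination Complex.I_sq
      have h3 : (1 - Complex.I) * -Complex.I = -Complex.I - 1 := by
        linear_combination Complex.I_sq
      rw [h2, h3]
      module)
  have hXs : ContDiffOn ℝ ∞ X e.target := by
    refine (z1.1.const_smul (1 / 2 : ℂ)).congr fun w _ => ?_
    simp [smul_smul]
  have hYs : ContDiffOn ℝ ∞ Y e.target := by
    refine (z1.2.1.const_smul (1 / 2 : ℂ)).congr fun w _ => ?_
    simp [smul_smul]
  have hshift : ∀ w ∈ e.target, star (Φ o (e.symm w)) * A w * Φ o (e.symm w) = (o : ℂ)⁻¹ • A w ∧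
      star (Φ o (e.symm w)) * B w * Φ o (e.symm w) = (o : ℂ) • B w := by
    intro w hw
    set P := Φ o (e.symm w) with hP
    -- Φ(-o) = Φ(-1)P is differentiated in two ways; the terms in A and B without conjugation by P
    -- combine to (1 + o⁻¹) - (1 - o⁻¹) = 2o⁻¹ and (1 + o) - (1 - o) = 2o.
    have h1 : ∀ v : ℂ, star P * ((2 * v) • A w + (2 * (starRingEnd ℂ) v) • B w) * P
        = (2 * (o : ℂ)⁻¹ * v) • A w + (2 * (o : ℂ) * (starRingEnd ℂ) v) • B w := by
      intro v
      have h2 := hd (o * m1) w hw v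
      have h3 : (fun u => Φ (o * m1) (e.symm u)) = fun u => Φ m1 (e.symm u) * Φ o (e.symm u) :=
        funext fun u => ho m1 _
      rw [h3, fderiv_mul_apply (hdiff m1 w hw) (hdiff o w hw), hd m1 w hw, hd o w hw, ho,
        ← hP] at h2
      have h4 := congrArg (fun x => star P * (star (Φ m1 (e.symm w)) * x)) h2
      simp only [mul_add, ← mul_assoc] at h4
      simp only [Circle.coe_mul, hm1] at h4
      rw [mul_assoc (star P) (star _), Unitary.star_mul_self_of_mem (hu m1 w hw), mul_one,
        Unitary.star_mul_self_of_mem (hu o w hw), one_mul, one_mul] at h4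
      simp only [add_mul] at h4
      simp only [mul_add, add_mul, mul_smul_comm, smul_mul_assoc] at h4 ⊢
      have h5 : ((o : ℂ) * -1)⁻¹ = -(o : ℂ)⁻¹ := by rw [mul_neg_one, inv_neg]
      rw [h5, show ((-1 : ℂ)⁻¹) = -1 by norm_num, one_mul, one_mul] at h4
      rw [← sub_eq_zero] at h4 ⊢
      rw [← h4]
      module
    have h2 := h1 1
    have h3 := h1 Complex.I
    simp only [_root_.map_one, mul_one, Complex.conj_I, mul_add, add_mul, mul_smul_comm,
      smul_mul_assoc] at h2 h3
    -- The real directions v = 1 and v = i separate the dz and d\bar z parts.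
    have h4 : ∀ (a b c d : Gl E),
        (2 : ℂ) • a + (2 : ℂ) • b = (2 * (o : ℂ)⁻¹) • c + (2 * (o : ℂ)) • d →
        (2 * Complex.I) • a + (2 * -Complex.I) • b
          = (2 * (o : ℂ)⁻¹ * Complex.I) • c + (2 * (o : ℂ) * -Complex.I) • d →
        a = (o : ℂ)⁻¹ • c ∧ b = (o : ℂ) • d := by
      intro a b c d ha hb
      have hI := Complex.I_mul_I
      constructor
      · have : a = (1 / 4 : ℂ) • ((2 : ℂ) • a + (2 : ℂ) • b)
            + (-Complex.I / 4) • ((2 * Complex.I) • a + (2 * -Complex.I) • b) := by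
          match_scalars
          · linear_combination (1 / 2) * hI
          · linear_combination -(1 / 2) * hI
        rw [this, ha, hb]
        match_scalars
        · linear_combination (-(o : ℂ)⁻¹ / 2) * hI
        · linear_combination ((o : ℂ) / 2) * hI
      · have : b = (1 / 4 : ℂ) • ((2 : ℂ) • a + (2 : ℂ) • b)
            - (-Complex.I / 4) • ((2 * Complex.I) • a + (2 * -Complex.I) • b) := by
          match_scalars
          · linear_combination (1 / 2) * hI
          · linear_combination -(1 / 2) * hI
        rw [this, ha, hb]
        match_scalars
        · linear_combination ((o : ℂ)⁻¹ / 2) * hI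
        · linear_combination (-(o : ℂ) / 2) * hI
    exact h4 _ _ _ _ h2 h3
  have ho0 : (o : ℂ) ≠ 0 := Circle.coe_ne_zero o
  have hA : ∀ w ∈ e.target, Φ o (e.symm w) * A w = (o : ℂ) • (A w * Φ o (e.symm w)) := by
    intro w hw
    have h := congrArg (fun x => Φ o (e.symm w) * x) (hshift w hw).1
    simp only [← mul_assoc, Unitary.mul_star_self_of_mem (hu o w hw), one_mul, mul_smul_comm] at h
    rw [h, smul_smul, mul_inv_cancel₀ ho0, one_smul]
  have hB : ∀ w ∈ e.target, Φ o (e.symm w) * B w = (o : ℂ)⁻¹ • (B w * Φ o (e.symm w)) := by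
    intro w hw
    have h := congrArg (fun x => Φ o (e.symm w) * x) (hshift w hw).2
    simp only [← mul_assoc, Unitary.mul_star_self_of_mem (hu o w hw), one_mul, mul_smul_comm] at h
    rw [h, smul_smul, inv_mul_cancel₀ ho0, one_smul]
  refine ⟨A, B, hXs, hYs, fun w hw => ?_, hA, hB, fun w hw => ⟨hdiff o w hw, fun v => ?_⟩⟩
  · have hXd : DifferentiableAt ℝ X w :=
      (hXs.contDiffAt (hT.mem_nhds hw)).differentiableAt (by simp)
    have hYd : DifferentiableAt ℝ Y w :=
      (hYs.contDiffAt (hT.mem_nhds hw)).differentiableAt (by simp)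
    have h1 := z1.2.2 w hw
    have h2 := z2.2.2 w hw
    rw [fderiv_fun_const_smul hXd, fderiv_fun_const_smul hYd] at h1
    rw [fderiv_fun_add hXd hYd, fderiv_fun_sub hYd hXd] at h2
    simp only [_root_.smul_apply, _root_.add_apply, _root_.sub_apply, smul_mul_assoc,
      mul_smul_comm] at h1 h2
    -- Curvature at -1 gives X_y - Y_x = 2[X, Y], and at i gives X_y - Y_x + X_x + Y_y = 2[X, Y];
    -- the difference is the divergence equation.
    have h3 : (2 : ℂ) • (fderiv ℝ X w Complex.I - fderiv ℝ Y w 1)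
        = (2 : ℂ) • ((2 : ℂ) • (X w * Y w - Y w * X w)) := by
      rw [smul_sub, h1]
      module
    have h4 := smul_right_injective (Gl E) (two_ne_zero (α := ℂ)) h3
    have h5 : (X w + Y w) * (Y w - X w) - (Y w - X w) * (X w + Y w)
        = (2 : ℂ) • (X w * Y w - Y w * X w) := by
      rw [two_smul]
      noncomm_ring
    rw [h5, ← h4] at h2
    rw [← sub_eq_zero] at h2
    rw [← h2]
    abel
  · rw [hd o w hw v]
    -- By the eigenvalue equations, (1 - o⁻¹)PA = PA - AP and (1 - o)PB = PB - BP.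
    simp only [mul_add, add_mul, mul_smul_comm, smul_mul_assoc, hA w hw, hB w hw, smul_smul]
    match_scalars <;> field_simp

end connection

/-! ### Shift connections and the degree of a lift -/

section shift

variable {M : Type*} [TopologicalSpace M]
  {E : Type*} [NormedAddCommGroup E] [InnerProductSpace ℂ E] [FiniteDimensional ℂ E]
  {l : ℕ} {s : ZMod l → ℕ}

theorem Flag.mem_grade_of_proj_mul [NeZero l] (x : Flag E l s) {d : ZMod l} {T : Gl E}
    (h : ∀ j, x.proj (j - d) * T = T * x.proj j) : T ∈ x.grade d := by
  intro j v hv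
  rw [← x.proj_apply_eq_self_iff, ← mul_apply_eq_comp, h, mul_apply_eq_comp,
    (x.proj_apply_eq_self_iff j).2 hv]

/-- In the coordinate `e` the projections of `φ` satisfy `dπ_i = [π_i, A dz + B d\bar z]`, where `A`
and `B` shift the decomposition by `1` and `-1`, and `(A + B, i (A - B))` is divergence free. -/
structure HasShiftConnection (φ : M → Flag E l s) (e : OpenPartialHomeomorph M ℂ)
    (A B : ℂ → Gl E) : Prop where
  smooth_add : ContDiffOn ℝ ∞ (fun w => A w + B w) e.target
  smooth_sub : ContDiffOn ℝ ∞ (fun w => Complex.I • (A w - B w)) e.target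
  div_eq_zero : ∀ w ∈ e.target, fderiv ℝ (fun w => A w + B w) w 1
    + fderiv ℝ (fun w => Complex.I • (A w - B w)) w Complex.I = 0
  shift_left : ∀ w ∈ e.target, ∀ i, (φ (e.symm w)).proj (i + 1) * A w
    = A w * (φ (e.symm w)).proj i
  shift_right : ∀ w ∈ e.target, ∀ i, (φ (e.symm w)).proj (i + -1) * B w
    = B w * (φ (e.symm w)).proj i
  isCommDeriv : ∀ w ∈ e.target, ∀ i, IsCommDeriv (fun u => (φ (e.symm u)).proj i) w
    (fun v => v • A w + (starRingEnd ℂ) v • B w)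

theorem HasShiftConnection.fderiv_one {φ : M → Flag E l s} {e : OpenPartialHomeomorph M ℂ}
    {A B : ℂ → Gl E} (h : HasShiftConnection φ e A B) {w : ℂ} (hw : w ∈ e.target) (i : ZMod l) :
    fderiv ℝ (fun u => (φ (e.symm u)).proj i) w 1
      = (φ (e.symm w)).proj i * (A w + B w) - (A w + B w) * (φ (e.symm w)).proj i := by
  rw [(h.isCommDeriv w hw i).2]
  simp

theorem HasShiftConnection.fderiv_I {φ : M → Flag E l s} {e : OpenPartialHomeomorph M ℂ}
    {A B : ℂ → Gl E} (h : HasShiftConnection φ e A B) {w : ℂ} (hw : w ∈ e.target) (i : ZMod l) :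
    fderiv ℝ (fun u => (φ (e.symm u)).proj i) w Complex.I
      = (φ (e.symm w)).proj i * (Complex.I • (A w - B w))
        - (Complex.I • (A w - B w)) * (φ (e.symm w)).proj i := by
  rw [(h.isCommDeriv w hw i).2]
  simp [sub_eq_add_neg]

theorem HasShiftConnection.dz_proj {φ : M → Flag E l s} {e : OpenPartialHomeomorph M ℂ}
    {A B : ℂ → Gl E} (h : HasShiftConnection φ e A B) {w : ℂ} (hw : w ∈ e.target) (i : ZMod l) :
    dz (fun u => (φ (e.symm u)).proj i) w
      = (φ (e.symm w)).proj i * A w - A w * (φ (e.symm w)).proj i := by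
  rw [dz, h.fderiv_one hw, h.fderiv_I hw]
  simp only [mul_smul_comm, smul_mul_assoc, mul_add, add_mul, mul_sub, sub_mul, smul_sub, smul_add,
    smul_smul]
  match_scalars <;>
    first
    | linear_combination (1 / 2) * Complex.I_mul_I
    | linear_combination (-1 / 2) * Complex.I_mul_I

variable [CompleteSpace E]

theorem proj_eq_conj_of_map {x y : Flag E l s} {U : Gl E} (hU : U ∈ unitary (Gl E))
    {i : ZMod l} (h : y.space i = (x.space i).map U.toLinearMap) :
    y.proj i = U * x.proj i * star U := by
  have h1 : LinearMap.range (U * x.proj i * star U).toLinearMap = y.space i := by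
    rw [h]
    ext v
    constructor
    · rintro ⟨w, rfl⟩
      exact ⟨x.proj i (star U w), x.proj_apply_mem _ _, rfl⟩
    · rintro ⟨w, hw, rfl⟩
      refine ⟨U w, ?_⟩
      change U (x.proj i (star U (U w))) = U w
      rw [star_apply_apply_of_mem_unitary hU, (x.proj_apply_eq_self_iff i).2 hw]
  have h2 : (U * x.proj i * star U) * (U * x.proj i * star U) = U * x.proj i * star U := by
    calc (U * x.proj i * star U) * (U * x.proj i * star U)
        = U * x.proj i * (star U * U) * x.proj i * star U := by noncomm_ring
      _ = U * (x.proj i * x.proj i) * star U := by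
        rw [Unitary.star_mul_self_of_mem hU]
        noncomm_ring
      _ = _ := by rw [x.proj_mul_proj, if_pos rfl]
  have h3 : star (U * x.proj i * star U) = U * x.proj i * star U := by
    rw [star_mul, star_mul, star_star, x.star_proj, mul_assoc]
  rw [← starProjection_range_of_star_eq h2 h3, Flag.proj]
  simp_rw [h1]

variable [ChartedSpace ℂ M] [IsManifold 𝓘(ℂ) ω M]

/-- With L = ψ⁻¹ψ_z and A' = ψ⁻¹Aψ, the identity L = (L + A') - A' splits L into degrees 0 and -1.
-/
theorem HasShiftConnection.star_mul_dz_mem [NeZero l] {φ : M → Flag E l s}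
    {e : OpenPartialHomeomorph M ℂ} (he : e ∈ IsManifold.maximalAtlas 𝓘(ℂ) ω M)
    {A B : ℂ → Gl E} (h : HasShiftConnection φ e A B) {x₀ : Flag E l s} {U : Set M} {ψ : M → Gl E}
    (hψ : IsLift x₀ φ U ψ) {z : M} (hz : z ∈ U ∩ e.source) :
    star (ψ z) * dz (fun w => ψ (e.symm w)) (e z) ∈ x₀.grade 0 ⊔ x₀.grade (-1) := by
  set w := e z with hw
  have hwT : w ∈ e.target := e.map_source hz.2
  have hez : e.symm w = z := e.left_inv hz.2
  set g : ℂ → Gl E := fun w => ψ (e.symm w) with hg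
  have hgz : g w = ψ z := by rw [hg]; simp only [hez]
  have hV : IsOpen (e.target ∩ e.symm ⁻¹' U) := e.isOpen_inter_preimage_symm hψ.isOpen
  have hwV : w ∈ e.target ∩ e.symm ⁻¹' U := ⟨hwT, by simpa only [Set.mem_preimage, hez] using hz.1⟩
  have hgs : ContDiffOn ℝ ∞ g (e.target ∩ e.symm ⁻¹' U) :=
    (hψ.smooth.comp ((contMDiffOn_real_symm he).mono Set.inter_subset_left)
      (fun u hu => hu.2)).contDiffOn
  have hgd : DifferentiableAt ℝ g w :=
    (hgs.contDiffAt (hV.mem_nhds hwV)).differentiableAt (by simp)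
  have hu := hψ.mem_unitary z hz.1
  set L := star (ψ z) * dz g w with hL
  have hdzg : dz g w = ψ z * L := by
    rw [hL, ← mul_assoc, Unitary.mul_star_self_of_mem hu, one_mul]
  set A' := star (ψ z) * A w * ψ z with hA'
  have hA : A w * ψ z = ψ z * A' := by
    rw [hA', ← mul_assoc, ← mul_assoc, Unitary.mul_star_self_of_mem hu, one_mul]
  clear_value A' L
  have hproj : ∀ y ∈ U, ∀ i, (φ y).proj i * ψ y = ψ y * x₀.proj i := by
    intro y hy i
    rw [proj_eq_conj_of_map (hψ.mem_unitary y hy) (hψ.eq_map y hy i), mul_assoc, mul_assoc,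
      Unitary.star_mul_self_of_mem (hψ.mem_unitary y hy), mul_one]
  have hcancel : ∀ {S T : Gl E}, ψ z * S = ψ z * T → S = T := by
    intro S T hST
    have := congrArg (fun x => star (ψ z) * x) hST
    simpa only [← mul_assoc, Unitary.star_mul_self_of_mem hu, one_mul] using this
  have hAshift : ∀ i, x₀.proj (i + 1) * A' = A' * x₀.proj i := by
    intro i
    apply hcancel
    have := h.shift_left w hwT i
    rw [hez] at this
    rw [← mul_assoc, ← hproj z hz.1, mul_assoc, ← hA, ← mul_assoc, this, mul_assoc, hproj z hz.1,
      ← mul_assoc, hA, mul_assoc]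
  -- Apply ∂_z to π_i ψ = ψ p_i, with p_i the projections of the base point, insert ∂_z π_i = [π_i,
  -- A] and cancel ψ.
  have hLcomm : ∀ i, x₀.proj i * (L + A') = (L + A') * x₀.proj i := by
    intro i
    have h1 : (fun u => (φ (e.symm u)).proj i * g u) =ᶠ[nhds w] fun u => g u * x₀.proj i := by
      filter_upwards [hV.mem_nhds hwV] with u hu using hproj _ hu.2 i
    have h2 : ∀ v, fderiv ℝ (fun u => (φ (e.symm u)).proj i) w v * ψ z
        + (φ z).proj i * fderiv ℝ g w v = fderiv ℝ g w v * x₀.proj i := by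
      intro v
      have h3 := congrArg (fun T => T v) (h1.fderiv_eq (𝕜 := ℝ))
      simp only [fderiv_mul_apply (h.isCommDeriv w hwT i).1 hgd,
        fderiv_mul_apply hgd (differentiableAt_const (x₀.proj i))] at h3
      simpa [hgz, hez] using h3
    have h3 : dz (fun u => (φ (e.symm u)).proj i) w * ψ z + (φ z).proj i * dz g w
        = dz g w * x₀.proj i := by
      simp only [dz, smul_mul_assoc, mul_smul_comm, sub_mul, mul_sub, ← h2, smul_sub, smul_add]
      abel
    rw [h.dz_proj hwT, hez, hdzg, sub_mul, mul_assoc, hA, mul_assoc (A w), hproj z hz.1,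
      ← mul_assoc, ← mul_assoc, ← mul_assoc, hA, hproj z hz.1] at h3
    apply hcancel
    rw [mul_add, mul_add, add_mul, mul_add]
    simp only [← mul_assoc]
    rw [← h3]
    abel
  have h0 : L + A' ∈ x₀.grade 0 := x₀.mem_grade_of_proj_mul fun j => by rw [sub_zero, hLcomm]
  have h1 : A' ∈ x₀.grade (-1) := x₀.mem_grade_of_proj_mul fun j => by
    rw [sub_neg_eq_add, hAshift]
  have : L = (L + A') - A' := by abel
  rw [this]
  exact Submodule.sub_mem _ (Submodule.mem_sup_left h0) (Submodule.mem_sup_right h1)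

end shift

/-! ### Square roots near the identity -/

section sqrt

variable {A : Type*} [NormedRing A] [NormedAlgebra ℝ A] [CompleteSpace A]

/-- Near `1` there is an analytic square root; it is equivariant for each continuous map which
preserves `1` and squares. -/
theorem exists_analytic_sqrt : ∃ r : A → A, r 1 = 1 ∧ (∀ᶠ T in nhds (1 : A), ContDiffAt ℝ ω r T) ∧
    (∀ᶠ T in nhds (1 : A), r T * r T = T) ∧
    ∀ g : A → A, Continuous g → g 1 = 1 → (∀ a, g (a * a) = g a * g a) →
      ∀ᶠ T in nhds (1 : A), g T = T → g (r T) = r T := by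
  let f' : A ≃L[ℝ] A := ContinuousLinearEquiv.smulLeft (Units.mk0 (2 : ℝ) two_ne_zero)
  have hf : ContDiff ℝ ω (fun T : A => T * T) := contDiff_id.mul contDiff_id
  have hf' : HasFDerivAt (fun T : A => T * T) (f' : A →L[ℝ] A) 1 := by
    have h := (hasFDerivAt_id (𝕜 := ℝ) (1 : A)).mul' (hasFDerivAt_id (𝕜 := ℝ) (1 : A))
    refine h.congr_fderiv ?_
    ext T
    change (1 : A) * T + T * 1 = (2 : ℝ) • T
    rw [one_mul, mul_one, two_smul]
  have hn : (ω : WithTop ℕ∞) ≠ 0 := by simp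
  let h := hf.contDiffAt.toOpenPartialHomeomorph (fun T : A => T * T) hf' hn
  have hcoe : ∀ T, h T = T * T := fun T => rfl
  have h1s : (1 : A) ∈ h.source :=
    hf.contDiffAt.mem_toOpenPartialHomeomorph_source hf' hn
  have h1t : (1 : A) ∈ h.target := by
    have := h.map_source h1s
    rwa [hcoe, one_mul] at this
  have hr1 : h.symm 1 = 1 := by
    have := h.left_inv h1s
    rwa [hcoe, one_mul] at this
  have hsm : ContDiffAt ℝ ω h.symm 1 :=
    h.contDiffAt_symm h1t (by rw [hr1]; exact hf') (by rw [hr1]; exact hf.contDiffAt)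
  refine ⟨h.symm, hr1, hsm.eventually (by simp), ?_, ?_⟩
  · filter_upwards [h.open_target.mem_nhds h1t] with T hT
    rw [← hcoe, h.right_inv hT]
  · intro g hg hg1 hgsq
    -- If g T = T, then g(r T) and r T have the same square; near 1 both lie where squaring is
    -- injective.
    have hc : ContinuousAt (fun T => g (h.symm T)) 1 :=
      ContinuousAt.comp (by rw [hr1]; exact hg.continuousAt) hsm.continuousAt
    have hmem : ∀ᶠ T in nhds (1 : A), g (h.symm T) ∈ h.source :=
      hc.eventually_mem (by simp only [hr1, hg1]; exact h.open_source.mem_nhds h1s)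
    filter_upwards [hmem, h.open_target.mem_nhds h1t] with T hT1 hT2 hgT
    refine h.injOn hT1 (h.map_target hT2) ?_
    rw [hcoe, ← hgsq, ← hcoe (h.symm T), h.right_inv hT2, hgT]

end sqrt

/-! ### Transitivity of U(n) and local lifts -/

section lift

variable {E : Type*} [NormedAddCommGroup E] [InnerProductSpace ℂ E] [FiniteDimensional ℂ E]
  [CompleteSpace E] {l : ℕ} {s : ZMod l → ℕ}

theorem mem_unitary_of_star_mul_self {U : Gl E} (h : star U * U = 1) : U ∈ unitary (Gl E) := by
  refine Unitary.mem_iff.2 ⟨h, ?_⟩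
  have h1 : (star U).toLinearMap * U.toLinearMap = 1 := by
    rw [← ContinuousLinearMap.toLinearMap_mul, h]
    rfl
  have h2 := mul_eq_one_comm.1 h1
  ext v
  exact congrArg (fun T : E →ₗ[ℂ] E => T v) h2

theorem Flag.space_eq_map [NeZero l] {x y : Flag E l s} {U : Gl E} (hU : U ∈ unitary (Gl E))
    {i : ZMod l} (h : y.proj i * U = U * x.proj i) :
    y.space i = (x.space i).map U.toLinearMap := by
  ext v
  constructor
  · intro hv
    refine ⟨x.proj i (star U v), x.proj_apply_mem _ _, ?_⟩
    change (U * x.proj i) (star U v) = v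
    rw [← h, mul_apply_eq_comp, ← mul_apply_eq_comp U, Unitary.mul_star_self_of_mem hU]
    exact (y.proj_apply_eq_self_iff i).2 hv
  · rintro ⟨w, hw, rfl⟩
    rw [← y.proj_apply_eq_self_iff]
    change (y.proj i * U) w = U w
    rw [h, mul_apply_eq_comp, (x.proj_apply_eq_self_iff i).2 hw]

/-- The unitary group acts transitively on the flag manifold. -/
theorem Flag.exists_unitary [NeZero l] (x y : Flag E l s) :
    ∃ U ∈ unitary (Gl E), ∀ i, y.proj i * U = U * x.proj i := by
  have hfin : ∀ i, Module.finrank ℂ (x.space i) = Module.finrank ℂ (y.space i) := fun i => by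
    rw [x.finrank_eq, y.finrank_eq]
  let f : ∀ i, x.space i ≃ₗᵢ[ℂ] y.space i := fun i =>
    (stdOrthonormalBasis ℂ (x.space i)).equiv (stdOrthonormalBasis ℂ (y.space i))
      (finCongr (hfin i))
  -- Partial isometries from x_i onto y_i, zero on the other summands; their sum is the required
  -- unitary.
  let c : ∀ i, Gl E := fun i => (y.space i).subtypeL ∘L
    ((f i).toContinuousLinearEquiv : x.space i →L[ℂ] y.space i) ∘L
      (x.space i).orthogonalProjectionOnto
  have hc : ∀ i v, c i v = f i ((x.space i).orthogonalProjectionOnto v) := fun i v => rfl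
  have hcmem : ∀ i v, c i v ∈ y.space i := fun i v => by
    rw [hc]
    exact Subtype.coe_prop _
  have hinner : ∀ i j v w, inner ℂ (c i v) (c j w)
      = if i = j then inner ℂ v (x.proj i w) else 0 := by
    intro i j v w
    split_ifs with hij
    · subst hij
      rw [hc, hc, ← Submodule.coe_inner, LinearIsometryEquiv.inner_map_map, Submodule.coe_inner]
      change inner ℂ (x.proj i v) (x.proj i w) = _
      rw [← x.star_proj, ContinuousLinearMap.star_eq_adjoint,
        ContinuousLinearMap.adjoint_inner_left, ← ContinuousLinearMap.star_eq_adjoint, x.star_proj,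
        ← mul_apply_eq_comp, x.proj_mul_proj, if_pos rfl]
    · exact Submodule.IsOrtho.inner_eq (y.orthogonal i j hij) (hcmem _ _) (hcmem _ _)
  have hcx : ∀ i j, c i * x.proj j = if i = j then c i else 0 := by
    intro i j
    ext v
    rw [mul_apply_eq_comp, hc]
    have h1 := x.proj_mul_proj i j
    have h2 : ((x.space i).orthogonalProjectionOnto (x.proj j v) : E) = (x.proj i * x.proj j) v :=
      rfl
    split_ifs with hij
    · subst hij
      rw [if_pos rfl] at h1
      rw [h1] at h2
      rw [hc]
      congr 2
      exact Subtype.ext h2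
    · rw [if_neg hij] at h1
      rw [h1] at h2
      have h3 : (x.space i).orthogonalProjectionOnto (x.proj j v) = 0 := Subtype.ext h2
      rw [h3]
      simp
  refine ⟨∑ i, c i, mem_unitary_of_star_mul_self ?_, fun j => ?_⟩
  · ext w
    refine ext_inner_left ℂ fun v => ?_
    rw [mul_apply_eq_comp, ContinuousLinearMap.star_eq_adjoint,
      ContinuousLinearMap.adjoint_inner_right, _root_.sum_apply, _root_.sum_apply, sum_inner]
    simp_rw [inner_sum, hinner]
    simp only [Finset.sum_ite_eq, Finset.mem_univ, if_true]
    rw [← inner_sum, ← _root_.sum_apply, x.sum_proj]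
  · rw [Finset.mul_sum, Finset.sum_mul]
    simp_rw [hcx]
    refine Finset.sum_congr rfl fun i _ => ?_
    ext v
    rw [mul_apply_eq_comp, y.proj_apply_of_mem (hcmem i v)]
    by_cases hij : i = j
    · simp [hij]
    · simp [hij, Ne.symm hij]

variable {M : Type*} [TopologicalSpace M] [ChartedSpace ℂ M]

/-- A smooth map into the flag manifold has local lifts. -/
theorem exists_isLift [NeZero l] {φ : M → Flag E l s} (hφ : IsSmooth φ) (x₀ : Flag E l s) (p : M) :
    ∃ (U : Set M) (ψ : M → Gl E), p ∈ U ∧ IsLift x₀ φ U ψ := by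
  obtain ⟨u, hu, hux⟩ := x₀.exists_unitary (φ p)
  obtain ⟨r, hr1, hrs, hrsq, hrg⟩ := exists_analytic_sqrt (A := Gl E)
  let π : ZMod l → Gl E := fun i => (φ p).proj i
  have hπ2 : ∀ i, π i * π i = π i := fun i => by
    simp only [π, (φ p).proj_mul_proj, if_true]
  -- Commuting with π_i means being fixed under conjugation by the reflection σ_i = 2π_i - 1. This
  -- conjugation preserves 1 and squares, so the square root is equivariant for it.
  let σ : ZMod l → Gl E := fun i => (2 : ℂ) • π i - 1
  have hσ : ∀ i, σ i * σ i = 1 := by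
    intro i
    simp only [σ, sub_mul, mul_sub, smul_mul_assoc, mul_smul_comm, hπ2, one_mul, mul_one]
    module
  have hcommσ : ∀ i T, σ i * T * σ i = T ↔ π i * T = T * π i := by
    intro i T
    have h1 : σ i * T * σ i = T ↔ σ i * T = T * σ i := by
      constructor
      · intro h
        have := congrArg (fun x => x * σ i) h
        simpa only [mul_assoc, hσ, mul_one] using this
      · intro h
        rw [h, mul_assoc, hσ, mul_one]
    rw [h1]
    simp only [σ, sub_mul, mul_sub, smul_mul_assoc, mul_smul_comm, one_mul, mul_one]
    rw [sub_left_inj]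
    exact (smul_right_injective (Gl E) (two_ne_zero (α := ℂ))).eq_iff
  have hstar : ∀ᶠ T in nhds (1 : Gl E), star T = T → star (r T) = r T :=
    hrg star continuous_star (star_one _) fun a => by rw [star_mul]
  have hcomm : ∀ᶠ T in nhds (1 : Gl E), ∀ i, π i * T = T * π i → π i * r T = r T * π i := by
    rw [Filter.eventually_all]
    intro i
    have := hrg (fun T => σ i * T * σ i) (by fun_prop) (by rw [mul_one, hσ]) fun a => by
      calc σ i * (a * a) * σ i = σ i * a * 1 * a * σ i := by noncomm_ring
        _ = σ i * a * σ i * (σ i * a * σ i) := by rw [← hσ i]; noncomm_ring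
    filter_upwards [this] with T hT h
    exact (hcommσ i _).1 (hT ((hcommσ i T).2 h))
  have hunit : ∀ᶠ T in nhds (1 : Gl E), IsUnit (r T) := by
    have hc : ContinuousAt r 1 := hrs.self_of_nhds.continuousAt
    exact hc.eventually_mem (by rw [hr1]; exact Units.isOpen.mem_nhds isUnit_one)
  obtain ⟨O, hO, hOo, h1O⟩ := eventually_nhds_iff.1 (hrs.and (hrsq.and (hstar.and
    (hcomm.and hunit))))
  -- S intertwines the projections at p and at z, and S(p) = 1. Its unitary part S(S*S)^{-1/2} still
  -- intertwines, because the square root of T = S*S is self-adjoint and commutes with each π_i.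
  let S : M → Gl E := fun z => ∑ i, (φ z).proj i * π i
  have hS : ContMDiff 𝓘(ℝ, ℂ) 𝓘(ℝ, Gl E) ∞ S := by
    have hcd : ContDiff ℝ ∞ fun q : ZMod l → Gl E => ∑ i, q i * π i :=
      ContDiff.sum fun i _ => (contDiff_apply ℝ (Gl E) i).mul contDiff_const
    exact hcd.contMDiff.comp (contMDiff_pi_space.2 hφ)
  let T : M → Gl E := fun z => star (S z) * S z
  have hT : ContMDiff 𝓘(ℝ, ℂ) 𝓘(ℝ, Gl E) ∞ T :=
    (contDiff_star.mul contDiff_id).contMDiff.comp hS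
  have hSπ : ∀ z j, (φ z).proj j * S z = S z * π j := by
    intro z j
    simp only [S, Finset.mul_sum, Finset.sum_mul, ← mul_assoc, (φ z).proj_mul_proj]
    simp only [mul_assoc, π, (φ p).proj_mul_proj]
    simp
  have hSp : S p = 1 := by
    simp only [S, π, (φ p).proj_mul_proj, if_true]
    exact (φ p).sum_proj
  have hTp : T p = 1 := by simp [T, hSp]
  have hTstar : ∀ z, star (T z) = T z := fun z => by simp [T]
  have hTπ : ∀ z i, π i * T z = T z * π i := by
    intro z i
    have h1 : π i * star (S z) = star (S z) * (φ z).proj i := by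
      have := congrArg star (hSπ z i)
      rw [star_mul, star_mul, (φ z).star_proj] at this
      rw [this]
      simp only [π, (φ p).star_proj]
    simp only [T]
    rw [← mul_assoc, h1, mul_assoc, hSπ, mul_assoc]
  have hVu : ∀ z ∈ T ⁻¹' O, S z * Ring.inverse (r (T z)) ∈ unitary (Gl E) ∧
      ∀ i, (φ z).proj i * (S z * Ring.inverse (r (T z)))
        = S z * Ring.inverse (r (T z)) * π i := by
    intro z hz
    obtain ⟨-, h2, h3, h4, h5⟩ := hO _ hz
    set R := r (T z) with hR
    have hRs := h3 (hTstar z)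
    have hinv1 := Ring.mul_inverse_cancel R h5
    have hinv2 := Ring.inverse_mul_cancel R h5
    have hQs : star (Ring.inverse R) = Ring.inverse R := by
      have h6 := congrArg star hinv1
      rw [star_mul, hRs, star_one] at h6
      exact left_inv_eq_right_inv h6 hinv1
    constructor
    · apply mem_unitary_of_star_mul_self
      rw [star_mul, hQs]
      calc Ring.inverse R * star (S z) * (S z * Ring.inverse R)
          = Ring.inverse R * T z * Ring.inverse R := by simp only [T, mul_assoc]
        _ = (Ring.inverse R * R) * (R * Ring.inverse R) := by rw [← h2]; simp only [mul_assoc]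
        _ = 1 := by rw [hinv1, hinv2, one_mul]
    · intro i
      have h6 : π i * Ring.inverse R = Ring.inverse R * π i := by
        have h7 := h4 i (hTπ z i)
        calc π i * Ring.inverse R = Ring.inverse R * (R * π i) * Ring.inverse R := by
              rw [← mul_assoc, hinv2, one_mul]
          _ = Ring.inverse R * π i := by
              rw [← h7, mul_assoc, mul_assoc, hinv1, mul_one]
      rw [← mul_assoc, hSπ, mul_assoc, h6, mul_assoc]
  refine ⟨T ⁻¹' O, fun z => S z * Ring.inverse (r (T z)) * u, by simpa [hTp] using h1O, ?_⟩
  refine ⟨hOo.preimage hT.continuous, ?_, fun z hz => mul_mem (hVu z hz).1 hu, fun z hz i => ?_⟩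
  · intro z hz
    obtain ⟨h1, -, -, -, h5⟩ := hO _ hz
    obtain ⟨a, ha⟩ := h5
    have hinv : ContDiffAt ℝ ∞ (fun x => Ring.inverse (r x)) (T z) := by
      have h6 := contDiffAt_ringInverse ℝ (n := ∞) a
      rw [ha] at h6
      exact h6.comp (T z) (h1.of_le le_top)
    have h7 : ContMDiffAt 𝓘(ℝ, ℂ) 𝓘(ℝ, Gl E) ∞ (fun z => Ring.inverse (r (T z))) z :=
      hinv.contMDiffAt.comp z hT.contMDiffAt
    have h8 : ContDiff ℝ ∞ fun q : Gl E × Gl E => q.1 * q.2 * u := by fun_prop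
    exact (h8.contMDiff.contMDiffAt.comp z
      (hS.contMDiffAt.prodMk_space h7)).contMDiffWithinAt
  · refine Flag.space_eq_map (mul_mem (hVu z hz).1 hu) ?_
    rw [← mul_assoc, (hVu z hz).2 i, mul_assoc, hux, ← mul_assoc]

theorem isPrimitive_of_hasShiftConnection [IsManifold 𝓘(ℂ) ω M] [NeZero l] {φ : M → Flag E l s}
    (hφ : IsSmooth φ)
    (h : ∀ e ∈ IsManifold.maximalAtlas 𝓘(ℂ) ω M, ∃ A B, HasShiftConnection φ e A B) :
    IsPrimitive φ := by
  refine ⟨hφ, fun x₀ => ⟨exists_isLift hφ x₀, fun U ψ hψ e he z hz => ?_⟩⟩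
  obtain ⟨A, B, hAB⟩ := h e he
  exact hAB.star_mul_dz_mem he hψ hz

end lift

/-! ### Divergence theorem and differentiation under the integral -/

section integrals

/-- The divergence theorem for a function supported in a compact set. -/
theorem setIntegral_fderiv_eq_zero {g : ℂ → ℝ} {T C : Set ℂ} (hT : IsOpen T) (hC : IsCompact C)
    (hCT : C ⊆ T) (hg : ContDiffOn ℝ ∞ g T) (h0 : ∀ w ∈ T, w ∉ C → g w = 0) (v : ℂ) :
    ∫ w in C, fderiv ℝ g w v = 0 := by
  -- Extension by zero is smooth on all of ℂ: the open sets T and the complement of C cover the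
  -- plane.
  set g' : ℂ → ℝ := C.indicator g with hg'
  have heq : ∀ w ∈ T, g' w = g w := by
    intro w hw
    by_cases hwC : w ∈ C
    · rw [hg', Set.indicator_of_mem hwC]
    · rw [hg', Set.indicator_of_notMem hwC, h0 w hw hwC]
  have hout : ∀ w ∉ C, g' =ᶠ[nhds w] fun _ => 0 := by
    intro w hw
    filter_upwards [hC.isClosed.isOpen_compl.mem_nhds hw] with y hy
    rw [hg', Set.indicator_of_notMem hy]
  have hin : ∀ w ∈ C, g' =ᶠ[nhds w] g := by
    intro w hw
    filter_upwards [hT.mem_nhds (hCT hw)] with y hy using heq y hy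
  have hcd : ContDiff ℝ ∞ g' := by
    rw [contDiff_iff_contDiffAt]
    intro w
    by_cases hw : w ∈ C
    · exact (hg.contDiffAt (hT.mem_nhds (hCT hw))).congr_of_eventuallyEq (hin w hw)
    · exact contDiffAt_const.congr_of_eventuallyEq (hout w hw)
  have hsupp : HasCompactSupport g' :=
    HasCompactSupport.intro hC fun w hw => by rw [hg', Set.indicator_of_notMem hw]
  have h1 : ∫ w, fderiv ℝ g' w v = 0 := by
    have hint : Integrable (fun w => fderiv ℝ g' w v) :=
      ((hcd.continuous_fderiv (by simp)).clm_apply continuous_const).integrable_of_hasCompactSupport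
        ((hsupp.fderiv ℝ).comp_left (g := fun T : ℂ →L[ℝ] ℝ => T v) (by simp))
    -- Integration by parts against the constant 1.
    have h2 := integral_mul_fderiv_eq_neg_fderiv_mul_of_integrable (𝕜 := ℝ) (μ := volume)
      (f := fun _ : ℂ => (1 : ℝ)) (g := g') (v := v) (by simp) (by simpa using hint)
      (by simpa using hcd.continuous.integrable_of_hasCompactSupport hsupp)
      (fun _ _ => differentiableAt_const _) (fun x _ => (hcd.differentiable (by simp)) x)
    simpa using h2
  rw [← setIntegral_eq_integral_of_forall_compl_eq_zero (s := C)] at h1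
  · rw [← h1]
    refine setIntegral_congr_fun hC.measurableSet fun w hw => ?_
    simp only [(hin w hw).fderiv_eq (𝕜 := ℝ)]
  · intro w hw
    rw [(hout w hw).fderiv_eq (𝕜 := ℝ)]
    simp

/-- Differentiation under the integral sign over a compact set. -/
theorem hasDerivAt_setIntegral {h : ℝ × ℂ → ℝ} {T C : Set ℂ} (hT : IsOpen T) (hC : IsCompact C)
    (hCT : C ⊆ T) (hh : ContDiffOn ℝ ∞ h (Set.univ ×ˢ T)) :
    HasDerivAt (fun t => ∫ w in C, h (t, w)) (∫ w in C, fderiv ℝ h (0, w) (1, 0)) 0 := by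
  have hO : IsOpen ((Set.univ : Set ℝ) ×ˢ T) := isOpen_univ.prod hT
  have hd : ContinuousOn (fun p => fderiv ℝ h p (1, 0)) (Set.univ ×ˢ T) :=
    ((hh.continuousOn_fderiv_of_isOpen hO (by simp)).clm_apply continuousOn_const)
  have hKc : IsCompact (Set.Icc (-1 : ℝ) 1 ×ˢ C) := isCompact_Icc.prod hC
  obtain ⟨b, hb⟩ := hKc.exists_bound_of_continuousOn
    (hd.mono (Set.prod_mono (Set.subset_univ _) hCT))
  have hslice : ∀ {g : ℝ × ℂ → ℝ}, ContinuousOn g (Set.univ ×ˢ T) → ∀ t : ℝ,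
      IntegrableOn (fun w => g (t, w)) C := fun {g} hg t =>
    (hg.comp (f := fun w => (t, w)) (by fun_prop)
      fun w hw => ⟨Set.mem_univ _, hCT hw⟩).integrableOn_compact hC
  refine (hasDerivAt_integral_of_dominated_loc_of_deriv_le (bound := fun _ => b)
    (F' := fun t w => fderiv ℝ h (t, w) (1, 0))
    (Icc_mem_nhds (by norm_num : (-1 : ℝ) < 0) (by norm_num : (0 : ℝ) < 1)) ?_ ?_ ?_ ?_ ?_ ?_).2
  · exact Filter.Eventually.of_forall fun t => (hslice hh.continuousOn t).aestronglyMeasurable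
  · exact hslice hh.continuousOn 0
  · exact (hslice hd 0).aestronglyMeasurable
  · exact (ae_restrict_iff' hC.measurableSet).2 (Filter.Eventually.of_forall fun w hw t ht =>
      hb (t, w) ⟨ht, hw⟩)
  · exact integrableOn_const hC.measure_lt_top.ne
  · refine (ae_restrict_iff' hC.measurableSet).2 (Filter.Eventually.of_forall fun w hw t _ => ?_)
    have h1 : HasFDerivAt h (fderiv ℝ h (t, w)) (t, w) :=
      ((hh.contDiffAt (hO.mem_nhds ⟨Set.mem_univ _, hCT hw⟩)).differentiableAt
        (by simp)).hasFDerivAt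
    exact h1.comp_hasDerivAt t ((hasDerivAt_id t).prodMk (hasDerivAt_const t w))

end integrals

/-! ### The real trace form -/

section trace

variable {E : Type*} [NormedAddCommGroup E] [InnerProductSpace ℂ E] [FiniteDimensional ℂ E]

/-- The real part of the trace. -/
noncomputable def reTrace (E : Type*) [NormedAddCommGroup E] [InnerProductSpace ℂ E]
    [FiniteDimensional ℂ E] : Gl E →L[ℝ] ℝ :=
  Complex.reCLM ∘L ((LinearMap.toContinuousLinearMap
    (LinearMap.trace ℂ E ∘ₗ ContinuousLinearMap.coeLM ℂ) : Gl E →L[ℂ] ℂ).restrictScalars ℝ)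

theorem reTrace_apply (T : Gl E) : reTrace E T = (LinearMap.trace ℂ E T.toLinearMap).re := rfl

theorem reTrace_mul_comm (S T : Gl E) : reTrace E (S * T) = reTrace E (T * S) := by
  rw [reTrace_apply, reTrace_apply]
  exact congrArg Complex.re (LinearMap.trace_mul_comm ℂ S.toLinearMap T.toLinearMap)

/-- Derivatives of projections are self-adjoint, so the energy density becomes a polynomial in them,
without adjoints. -/
theorem hsNormSq_eq [CompleteSpace E] {T : Gl E} (hT : star T = T) :
    hsNormSq T = reTrace E (T * T) := by
  rw [hsNormSq, hT, reTrace_apply]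

end trace

/-! ### Tangent and normal vectors of the flag manifold -/

section tangent

variable {E : Type*} [NormedAddCommGroup E] [InnerProductSpace ℂ E] [FiniteDimensional ℂ E]
  {l : ℕ} [NeZero l] {s : ZMod l → ℕ}

/-- Tangent vectors of the flag manifold are given by commutators with the projections. -/
theorem exists_commutator_of_hasDerivAt {y : ℝ → Flag E l s} {η : ZMod l → Gl E} {t : ℝ}
    (hη : ∀ i, HasDerivAt (fun t => (y t).proj i) (η i) t) :
    ∃ Z : Gl E, ∀ j, η j = Z * (y t).proj j - (y t).proj j * Z := by
  -- Differentiating π_j π_i = δ_{ji} π_i and multiplying by π_i on the right gives π_j η_i π_i =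
  -- δ_{ji} η_j π_j - η_j π_i; summing over i yields π_j Z = η_j π_j - η_j, while Z π_j = η_j π_j.
  refine ⟨∑ i, η i * (y t).proj i, fun j => ?_⟩
  have h1 : ∀ i, η j * (y t).proj i + (y t).proj j * η i = if j = i then η i else 0 := by
    intro i
    have h2 := (hη j).mul (hη i)
    have h3 : ((fun t => (y t).proj j) * fun t => (y t).proj i)
        = fun t => if j = i then (y t).proj i else 0 :=
      funext fun t => (y t).proj_mul_proj j i
    rw [h3] at h2
    split_ifs at h2 ⊢ with hij
    · exact h2.unique (hη i)
    · exact h2.unique (hasDerivAt_const _ _)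
  have h2 : ∀ i, (y t).proj j * (η i * (y t).proj i)
      = (if i = j then η j * (y t).proj j else 0) - η j * (y t).proj i := by
    intro i
    have h3 := congrArg (fun x => x * (y t).proj i) (h1 i)
    simp only [add_mul, mul_assoc, (y t).proj_mul_proj, if_true] at h3
    rw [← sub_eq_iff_eq_add'.2 h3.symm]
    by_cases hij : i = j
    · subst hij
      simp
    · simp [hij, Ne.symm hij]
  simp only [Finset.mul_sum, Finset.sum_mul, mul_assoc, h2, (y t).proj_mul_proj]
  rw [Finset.sum_sub_distrib, ← Finset.mul_sum, (y t).sum_proj]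
  simp

/-- `ad(π_i)²`, summed over `i`, is a scalar on the operators which shift the decomposition. -/
theorem Flag.sum_ad_ad_of_shift (x : Flag E l s) {d : ZMod l} {A : Gl E}
    (hA : ∀ i, x.proj (i + d) * A = A * x.proj i) :
    ∑ i, (x.proj i * (x.proj i * A - A * x.proj i) - (x.proj i * A - A * x.proj i) * x.proj i)
      = (if d = 0 then (0 : ℂ) else 2) • A := by
  -- A shift by d ≠ 0 has no diagonal blocks, so ad(π_i)² A = π_i A + A π_i, with sum 2A. For d = 0
  -- the operator A commutes with every π_i and the sum is 0.
  have h1 : ∀ i, x.proj i * A * x.proj i = if d = 0 then A * x.proj i else 0 := by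
    intro i
    rw [show x.proj i * A = A * x.proj (i - d) by rw [← hA, sub_add_cancel], mul_assoc,
      x.proj_mul_proj]
    by_cases hd : d = 0 <;> simp [hd]
  have h2 : ∀ i, x.proj i * (x.proj i * A - A * x.proj i)
      - (x.proj i * A - A * x.proj i) * x.proj i
      = x.proj i * A + A * x.proj i - (2 : ℂ) • if d = 0 then A * x.proj i else 0 := by
    intro i
    rw [← h1, mul_sub, sub_mul, ← mul_assoc, ← mul_assoc, mul_assoc A, x.proj_mul_proj,
      if_pos rfl, two_smul]
    abel
  simp_rw [h2]
  rw [Finset.sum_sub_distrib, Finset.sum_add_distrib, ← Finset.sum_mul, ← Finset.mul_sum,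
    x.sum_proj, ← Finset.smul_sum]
  by_cases hd : d = 0
  · simp only [hd, if_true]
    rw [← Finset.mul_sum, x.sum_proj, one_mul, mul_one, zero_smul, two_smul, sub_self]
  · simp only [hd, if_false, Finset.sum_const_zero]
    rw [one_mul, mul_one, smul_zero, sub_zero, two_smul]

/-- If `∑ ad(π_i)² X` is a multiple of `X` then the vector `[[π_i, X], X]` is orthogonal to the
tangent space of the flag manifold. -/
theorem Flag.sum_reTrace_eq_zero (x : Flag E l s) {X : Gl E} {κ : ℂ}
    (hX : ∑ i, (x.proj i * (x.proj i * X - X * x.proj i)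
      - (x.proj i * X - X * x.proj i) * x.proj i) = κ • X) (Z : Gl E) :
    ∑ i, reTrace E (((x.proj i * X - X * x.proj i) * X - X * (x.proj i * X - X * x.proj i))
      * (Z * x.proj i - x.proj i * Z)) = 0 := by
  -- Invariance of the trace moves ad(π_i) onto [[π_i, X], X]; by the Jacobi identity the result is
  -- [ad(π_i)² X, X], since [[π_i, X], [π_i, X]] = 0. The sum over i is then [κX, X] = 0.
  have h1 : ∀ i, reTrace E (((x.proj i * X - X * x.proj i) * X
      - X * (x.proj i * X - X * x.proj i)) * (Z * x.proj i - x.proj i * Z))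
      = reTrace E (((x.proj i * (x.proj i * X - X * x.proj i)
        - (x.proj i * X - X * x.proj i) * x.proj i) * X - X * (x.proj i *
        (x.proj i * X - X * x.proj i) - (x.proj i * X - X * x.proj i) * x.proj i)) * Z) := by
    intro i
    set p := x.proj i
    set Y := p * X - X * p with hY
    have h2 : reTrace E ((Y * X - X * Y) * (Z * p)) = reTrace E (p * (Y * X - X * Y) * Z) := by
      rw [← mul_assoc, reTrace_mul_comm, mul_assoc]
    rw [mul_sub, map_sub, h2, ← mul_assoc, ← map_sub, ← sub_mul]
    congr 2
    rw [hY]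
    noncomm_ring
  simp_rw [h1]
  rw [← map_sum, ← Finset.sum_mul, Finset.sum_sub_distrib, ← Finset.sum_mul, ← Finset.mul_sum, hX]
  simp

end tangent

/-! ### First variation of the energy -/

section firstVariation

variable {E : Type*} [NormedAddCommGroup E] [InnerProductSpace ℂ E]

theorem fderiv_slice {F : Type*} [NormedAddCommGroup F] [NormedSpace ℝ F] {f : ℝ × ℂ → F} {t : ℝ}
    {w : ℂ} (hf : DifferentiableAt ℝ f (t, w)) (v : ℂ) :
    fderiv ℝ (fun u => f (t, u)) w v = fderiv ℝ f (t, w) (0, v) := by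
  have h := hf.hasFDerivAt.comp w ((hasFDerivAt_const t w).prodMk (hasFDerivAt_id w))
  rw [show (fun u => f (t, u)) = f ∘ fun u => (t, u) from rfl, h.fderiv]
  rfl

theorem fderiv_fderiv_of_commutator {p X : ℂ → Gl E} {T : Set ℂ} (hT : IsOpen T) {w v : ℂ}
    (hw : w ∈ T) (hp : DifferentiableAt ℝ p w) (hX : DifferentiableAt ℝ X w)
    (h : ∀ u ∈ T, fderiv ℝ p u v = p u * X u - X u * p u) :
    fderiv ℝ (fun u => fderiv ℝ p u v) w v
      = ((p w * X w - X w * p w) * X w - X w * (p w * X w - X w * p w))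
        + (p w * fderiv ℝ X w v - fderiv ℝ X w v * p w) := by
  have h1 : (fun u => fderiv ℝ p u v) =ᶠ[nhds w] fun u => p u * X u - X u * p u := by
    filter_upwards [hT.mem_nhds hw] with u hu using h u hu
  rw [h1.fderiv_eq, fderiv_fun_sub (hp.fun_mul hX) (hX.fun_mul hp), _root_.sub_apply,
    fderiv_mul_apply hp hX, fderiv_mul_apply hX hp, h w hw]
  abel

variable [FiniteDimensional ℂ E]

theorem fderiv_reTrace_mul {V : Type*} [NormedAddCommGroup V] [NormedSpace ℝ V] {f g : V → Gl E}
    {w : V} (hf : DifferentiableAt ℝ f w) (hg : DifferentiableAt ℝ g w) (v : V) :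
    fderiv ℝ (fun u => reTrace E (f u * g u)) w v
      = reTrace E (fderiv ℝ f w v * g w + f w * fderiv ℝ g w v) := by
  have h := (reTrace E).hasFDerivAt.comp w (hf.fun_mul hg).hasFDerivAt
  rw [show (fun u => reTrace E (f u * g u)) = reTrace E ∘ fun u => f u * g u from rfl, h.fderiv,
    ← fderiv_mul_apply hf hg]
  rfl

variable {M : Type*} [TopologicalSpace M] {l : ℕ} [NeZero l] {s : ZMod l → ℕ}

/-- The Laplacian of a map with a shift connection is normal to the flag manifold. -/
theorem HasShiftConnection.sum_reTrace_laplacian {φ : M → Flag E l s}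
    {e : OpenPartialHomeomorph M ℂ} {A B : ℂ → Gl E} (h : HasShiftConnection φ e A B) {w : ℂ}
    (hw : w ∈ e.target) (Z : Gl E) :
    ∑ i, reTrace E
      ((fderiv ℝ (fun u => fderiv ℝ (fun u => (φ (e.symm u)).proj i) u 1) w 1
        + fderiv ℝ (fun u => fderiv ℝ (fun u => (φ (e.symm u)).proj i) u Complex.I) w Complex.I)
      * (Z * (φ (e.symm w)).proj i - (φ (e.symm w)).proj i * Z)) = 0 := by
  have hT := e.open_target
  have hd : ∀ {g : ℂ → Gl E}, ContDiffOn ℝ ∞ g e.target → DifferentiableAt ℝ g w := fun hg =>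
    (hg.contDiffAt (hT.mem_nhds hw)).differentiableAt (by simp)
  have hA := (φ (e.symm w)).sum_ad_ad_of_shift (h.shift_left w hw)
  have hB := (φ (e.symm w)).sum_ad_ad_of_shift (h.shift_right w hw)
  -- The shifts 1 and -1 vanish in ℤ/l together, only for l = 1; hence A and B, and so X and Y,
  -- share the same scalar κ.
  simp only [neg_eq_zero] at hB
  have hX := (φ (e.symm w)).sum_reTrace_eq_zero (X := A w + B w)
    (κ := if (1 : ZMod l) = 0 then (0 : ℂ) else 2) (by
      rw [smul_add, ← hA, ← hB, ← Finset.sum_add_distrib]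
      exact Finset.sum_congr rfl fun i _ => by noncomm_ring) Z
  have hY := (φ (e.symm w)).sum_reTrace_eq_zero (X := Complex.I • (A w - B w))
    (κ := if (1 : ZMod l) = 0 then (0 : ℂ) else 2) (by
      rw [smul_comm, smul_sub (if (1 : ZMod l) = 0 then (0 : ℂ) else 2), ← hA, ← hB,
        ← Finset.sum_sub_distrib, Finset.smul_sum]
      refine Finset.sum_congr rfl fun i _ => ?_
      simp only [mul_smul_comm, smul_mul_assoc, ← smul_sub]
      congr 1
      noncomm_ring) Z
  rw [← add_zero (0 : ℝ)]
  nth_rw 1 [← hX]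
  rw [← hY, ← Finset.sum_add_distrib]
  refine Finset.sum_congr rfl fun i _ => ?_
  rw [← map_add, ← add_mul]
  congr 2
  have hp := (h.isCommDeriv w hw i).1
  -- The second derivatives also contain [π_i, X_x] and [π_i, Y_y], which cancel by the divergence
  -- equation.
  rw [fderiv_fderiv_of_commutator hT hw hp (hd h.smooth_add) (fun u hu => h.fderiv_one hu i),
    fderiv_fderiv_of_commutator hT hw hp (hd h.smooth_sub) (fun u hu => h.fderiv_I hu i),
    eq_neg_of_add_eq_zero_left (h.div_eq_zero w hw)]
  noncomm_ring

variable [CompleteSpace E] [ChartedSpace ℂ M] [IsManifold 𝓘(ℂ) ω M]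

/-- With η the variation field, the derivative of the density is twice div⟨∇π, η⟩ - ⟨Δπ, η⟩. The
last term vanishes because Δπ is normal and η tangent, and the divergence integrates to 0 because η
vanishes off K. -/
theorem isHarmonic_of_hasShiftConnection {φ : M → Flag E l s} (hφ : IsSmooth φ)
    (h : ∀ e ∈ IsManifold.maximalAtlas 𝓘(ℂ) ω M, ∃ A B, HasShiftConnection φ e A B) :
    IsHarmonic φ := by
  refine ⟨hφ, fun e he K hKe hK F hF hF0 hFK => ?_⟩
  obtain ⟨A, B, hAB⟩ := h e he
  have hT := e.open_target
  have hC : IsCompact (e '' K) := hK.image_of_continuousOn (e.continuousOn.mono hKe)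
  have hCT : e '' K ⊆ e.target := by
    rintro _ ⟨z, hz, rfl⟩
    exact e.map_source (hKe hz)
  have hO : IsOpen ((Set.univ : Set ℝ) ×ˢ e.target) := isOpen_univ.prod hT
  let G : ZMod l → ℝ × ℂ → Gl E := fun i p => (F p.1 (e.symm p.2)).proj i
  have hG : ∀ i, ContDiffOn ℝ ∞ (G i) (Set.univ ×ˢ e.target) := fun i =>
    contDiffOn_comp_prod_symm he (hF i)
  have hDG : ∀ i (v : ℝ × ℂ), ContDiffOn ℝ ∞ (fun p => fderiv ℝ (G i) p v)
      (Set.univ ×ˢ e.target) := fun i v =>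
    ((hG i).fderiv_of_isOpen hO (by norm_cast)).clm_apply contDiffOn_const
  have hda : ∀ {g : ℝ × ℂ → Gl E}, ContDiffOn ℝ ∞ g (Set.univ ×ˢ e.target) →
      ∀ (t : ℝ) {w : ℂ}, w ∈ e.target → DifferentiableAt ℝ g (t, w) := fun hg t w hw =>
    (hg.contDiffAt (hO.mem_nhds ⟨Set.mem_univ _, hw⟩)).differentiableAt (by simp)
  have hslice : ∀ {g : ℝ × ℂ → Gl E}, ContDiffOn ℝ ∞ g (Set.univ ×ˢ e.target) →
      ContDiffOn ℝ ∞ (fun w => g (0, w)) e.target := fun hg =>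
    hg.comp (contDiffOn_const.prodMk contDiffOn_id) fun w hw => ⟨Set.mem_univ _, hw⟩
  let D : ℂ → ZMod l → ℝ × ℂ → Gl E := fun v i p => fderiv ℝ (G i) p (0, v)
  let η : ZMod l → ℂ → Gl E := fun i w => fderiv ℝ (G i) (0, w) (1, 0)
  have hD : ∀ t, ∀ w ∈ e.target, ∀ v i,
      fderiv ℝ (fun u => (F t (e.symm u)).proj i) w v = D v i (t, w) := fun t w hw v i =>
    fderiv_slice (hda (hG i) t hw) v
  have hDstar : ∀ t, ∀ w ∈ e.target, ∀ v i, star (D v i (t, w)) = D v i (t, w) := by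
    intro t w hw v i
    rw [← hD t w hw]
    have h1 := fderiv_star (𝕜 := ℝ) (f := fun u => (F t (e.symm u)).proj i) (x := w)
    simp only [Flag.star_proj] at h1
    exact (congrArg (fun L => L v) h1).symm
  let dens : ℝ × ℂ → ℝ := fun p => ∑ i, (reTrace E (D 1 i p * D 1 i p)
    + reTrace E (D Complex.I i p * D Complex.I i p))
  have htr : ∀ {V : Type} [NormedAddCommGroup V] [NormedSpace ℝ V] {S : Set V} {f g : V → Gl E},
      ContDiffOn ℝ ∞ f S → ContDiffOn ℝ ∞ g S →
      ContDiffOn ℝ ∞ (fun x => reTrace E (f x * g x)) S := fun hf hg =>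
    (reTrace E).contDiff.comp_contDiffOn (hf.mul hg)
  have hdens : ContDiffOn ℝ ∞ dens (Set.univ ×ˢ e.target) :=
    ContDiffOn.sum fun i _ => (htr (hDG i _) (hDG i _)).add (htr (hDG i _) (hDG i _))
  have henergy : ∀ t, energy e K (F t)
      = (1 / 2) * ((Module.finrank ℂ E : ℝ) * ∫ w in e '' K, dens (t, w)) := by
    intro t
    rw [energy, integral_const_mul]
    refine congrArg (fun r : ℝ => 1 / 2 * ((Module.finrank ℂ E : ℝ) * r))
      (setIntegral_congr_fun hC.measurableSet fun w hw => ?_)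
    simp only [dens]
    refine Finset.sum_congr rfl fun i _ => ?_
    rw [hD t w (hCT hw), hD t w (hCT hw), hsNormSq_eq (hDstar t w (hCT hw) _ _),
      hsNormSq_eq (hDstar t w (hCT hw) _ _)]
  -- The components ⟨∂_v π, η⟩ of the vector field whose divergence appears in the first variation.
  let Ω : ℂ → ℂ → ℝ := fun v w => ∑ i, reTrace E (D v i (0, w) * η i w)
  have hΩ : ∀ v, ContDiffOn ℝ ∞ (Ω v) e.target := fun v =>
    ContDiffOn.sum fun i _ => htr (hslice (hDG i _)) (hslice (hDG i _))
  have hηd : ∀ w ∈ e.target, ∀ i, HasDerivAt (fun t => G i (t, w)) (η i w) 0 := fun w hw i =>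
    HasFDerivAt.comp_hasDerivAt (l := G i) (f := fun t => (t, w)) (0 : ℝ)
      (hda (hG i) 0 hw).hasFDerivAt ((hasDerivAt_id (0 : ℝ)).prodMk (hasDerivAt_const (0 : ℝ) w))
  have hΩ0 : ∀ v, ∀ w ∈ e.target, w ∉ e '' K → Ω v w = 0 := by
    intro v w hw hwK
    have h1 : ∀ i, η i w = 0 := by
      intro i
      have h2 : e.symm w ∉ K := fun h => hwK ⟨_, h, e.right_inv hw⟩
      have h3 : (fun t => G i (t, w)) = fun _ => (φ (e.symm w)).proj i := by
        funext t
        simp only [G, hFK t _ h2]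
      have h4 := hηd w hw i
      rw [h3] at h4
      exact h4.unique (hasDerivAt_const _ _)
    simp only [Ω, h1, mul_zero, map_zero, Finset.sum_const_zero]
  have hpt : ∀ w ∈ e.target, fderiv ℝ dens (0, w) (1, 0)
      = 2 * (fderiv ℝ (Ω 1) w 1 + fderiv ℝ (Ω Complex.I) w Complex.I) := by
    intro w hw
    have hDd : ∀ v i, DifferentiableAt ℝ (D v i) (0, w) := fun v i => hda (hDG i _) 0 hw
    have htd : ∀ v i, DifferentiableAt ℝ (fun p => reTrace E (D v i p * D v i p)) (0, w) :=
      fun v i => (reTrace E).differentiableAt.comp _ ((hDd v i).fun_mul (hDd v i))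
    have hsd : ∀ {g : ℝ × ℂ → Gl E}, ContDiffOn ℝ ∞ g (Set.univ ×ˢ e.target) →
        DifferentiableAt ℝ (fun w => g (0, w)) w := fun hg =>
      ((hslice hg).contDiffAt (hT.mem_nhds hw)).differentiableAt (by simp)
    -- Equality of mixed partials: the derivative of η along the surface is the t-derivative of the
    -- spatial derivative.
    have hmix : ∀ v i, fderiv ℝ (η i) w v = fderiv ℝ (D v i) (0, w) (1, 0) := by
      intro v i
      rw [fderiv_fderiv_comm hO (hG i) ⟨Set.mem_univ _, hw⟩, ← fderiv_slice (hda (hDG i _) 0 hw)]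
    have hdensd : fderiv ℝ dens (0, w) (1, 0) = 2 * ∑ i, (reTrace E (D 1 i (0, w)
        * fderiv ℝ (η i) w 1) + reTrace E (D Complex.I i (0, w)
        * fderiv ℝ (η i) w Complex.I)) := by
      simp only [dens]
      rw [fderiv_fun_sum fun i _ => (htd 1 i).fun_add (htd Complex.I i), _root_.sum_apply,
        Finset.mul_sum]
      refine Finset.sum_congr rfl fun i _ => ?_
      rw [fderiv_fun_add (htd 1 i) (htd Complex.I i), _root_.add_apply,
        fderiv_reTrace_mul (hDd 1 i) (hDd 1 i), fderiv_reTrace_mul (hDd _ i) (hDd _ i),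
        map_add, map_add, reTrace_mul_comm (fderiv ℝ (D 1 i) (0, w) (1, 0)),
        reTrace_mul_comm (fderiv ℝ (D Complex.I i) (0, w) (1, 0)), hmix, hmix]
      ring
    have hΩd : ∀ v, fderiv ℝ (Ω v) w v = ∑ i, (reTrace E
        (fderiv ℝ (fun u => fderiv ℝ (fun u => (φ (e.symm u)).proj i) u v) w v * η i w)
        + reTrace E (D v i (0, w) * fderiv ℝ (η i) w v)) := by
      intro v
      simp only [Ω]
      have hd : ∀ i, DifferentiableAt ℝ (fun w => reTrace E (D v i (0, w) * η i w)) w := fun i =>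
        (reTrace E).differentiableAt.comp w ((hsd (hDG i _)).fun_mul (hsd (hDG i _)))
      rw [fderiv_fun_sum fun i _ => hd i, _root_.sum_apply]
      refine Finset.sum_congr rfl fun i _ => ?_
      have h1 : (fun u => fderiv ℝ (fun u => (φ (e.symm u)).proj i) u v) =ᶠ[nhds w]
          fun u => D v i (0, u) := by
        filter_upwards [hT.mem_nhds hw] with u hu
        rw [← hF0, hD 0 u hu]
      rw [h1.fderiv_eq, ← map_add]
      exact fderiv_reTrace_mul (hsd (hDG i _)) (hsd (hDG i _)) v
    have hlap : ∑ i, reTrace E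
        (fderiv ℝ (fun u => fderiv ℝ (fun u => (φ (e.symm u)).proj i) u 1) w 1 * η i w)
        + ∑ i, reTrace E (fderiv ℝ (fun u => fderiv ℝ (fun u => (φ (e.symm u)).proj i) u
          Complex.I) w Complex.I * η i w) = 0 := by
      obtain ⟨Z, hZ⟩ := exists_commutator_of_hasDerivAt (y := fun t => F t (e.symm w))
        (hηd w hw)
      rw [← hAB.sum_reTrace_laplacian hw Z, ← Finset.sum_add_distrib]
      refine Finset.sum_congr rfl fun i _ => ?_
      rw [← map_add, ← add_mul, hZ i]
      simp only [hF0]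
    rw [hdensd, hΩd, hΩd, Finset.sum_add_distrib, Finset.sum_add_distrib, Finset.sum_add_distrib]
    linear_combination -2 * hlap
  have hder := hasDerivAt_setIntegral hT hC hCT hdens
  have hzero : ∫ w in e '' K, fderiv ℝ dens (0, w) (1, 0) = 0 := by
    have hint : ∀ v, IntegrableOn (fun w => fderiv ℝ (Ω v) w v) (e '' K) := fun v =>
      ((((hΩ v).continuousOn_fderiv_of_isOpen hT (by simp)).clm_apply
        continuousOn_const).mono hCT).integrableOn_compact hC
    rw [setIntegral_congr_fun hC.measurableSet fun w hw => hpt w (hCT hw), integral_const_mul,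
      integral_add (hint 1) (hint Complex.I),
      setIntegral_fderiv_eq_zero hT hC hCT (hΩ 1) (hΩ0 1),
      setIntegral_fderiv_eq_zero hT hC hCT (hΩ Complex.I) (hΩ0 Complex.I), add_zero, mul_zero]
  rw [hzero] at hder
  have := (hder.const_mul (Module.finrank ℂ E : ℝ)).const_mul (1 / 2)
  simp only [mul_zero] at this
  exact this.congr_of_eventuallyEq (Filter.Eventually.of_forall henergy)

end firstVariation

/-! ### Constancy of rank and conclusion -/

section main

variable {M : Type*} [TopologicalSpace M]
  {E : Type*} [NormedAddCommGroup E] [InnerProductSpace ℂ E]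

theorem pow_mul_eq_smul {P A : Gl E} {c : ℂ} (h : P * A = c • (A * P)) (m : ℕ) :
    P ^ m * A = c ^ m • (A * P ^ m) := by
  induction m with
  | zero => simp
  | succ m ih =>
    rw [pow_succ', mul_assoc, ih, mul_smul_comm, ← mul_assoc, h, smul_mul_assoc, smul_smul,
      mul_assoc, pow_succ]

theorem contDiff_specProj {l : ℕ} [NeZero l] (i : ZMod l) (m : ℕ) :
    ContDiff ℝ ∞ fun T : Gl E => specProj (T ^ m) i :=
  ContDiff.const_smul (l : ℂ)⁻¹ (ContDiff.sum fun j _ =>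
    ContDiff.const_smul (ZMod.stdAddChar (-(j * i))) ((contDiff_id.pow m).pow j.val))

/-- The rank of a continuous family of idempotents on a connected space is constant. -/
theorem finrank_range_eq_of_continuous [FiniteDimensional ℂ E] [PreconnectedSpace M] {p : M → Gl E}
    (hp : Continuous p) (h : ∀ z, p z * p z = p z) (z z' : M) :
    Module.finrank ℂ (LinearMap.range (p z).toLinearMap)
      = Module.finrank ℂ (LinearMap.range (p z').toLinearMap) := by
  have h1 : ∀ z, reTrace E (p z)
      = (Module.finrank ℂ (LinearMap.range (p z).toLinearMap) : ℝ) := by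
    intro z
    have hid : IsIdempotentElem (p z).toLinearMap :=
      congrArg ContinuousLinearMap.toLinearMap (h z)
    rw [reTrace_apply, (LinearMap.IsIdempotentElem.isProj_range _ hid).trace]
    -- The trace of an idempotent is its rank, so the rank is continuous and integer-valued.
    simp
  have h2 : Continuous fun z =>
      (Module.finrank ℂ (LinearMap.range (p z).toLinearMap) : ℝ) := by
    simp_rw [← h1]
    exact (reTrace E).continuous.comp hp
  exact PreconnectedSpace.constant inferInstance
    (Nat.isClosedEmbedding_coe_real.isInducing.continuous_iff.2 h2)

end main

end KSymHarmonic

open KSymHarmonic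

theorem theorem5p1 {M : Type*} [TopologicalSpace M] [T2Space M] [ConnectedSpace M]
    [ChartedSpace ℂ M] [IsManifold 𝓘(ℂ) ω M]
    (n k l : ℕ) [NeZero l] (hk : 2 ≤ k) (hl : l ∣ k)
    (Φ : Circle → M → KSymHarmonic.Gl (KSymHarmonic.Cn n))
    (hΦ : KSymHarmonic.IsExtendedSolution Φ)
    (hW : ∀ z, KSymHarmonic.IsKSymmetric k (KSymHarmonic.mulHardy (fun c => Φ c z))) :
    ∃ (s : ZMod l → ℕ) (φ : M → KSymHarmonic.Flag (KSymHarmonic.Cn n) l s),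
      (∀ z i, (φ z).space i = KSymHarmonic.sumBundle Φ k l i z) ∧
      (∀ z i, Module.finrank ℂ (KSymHarmonic.sumBundle Φ k l i z) = s i) ∧
      KSymHarmonic.IsPrimitiveHarmonic φ := by
  have hk0 : k ≠ 0 := by omega
  set o := rootOfUnity k with ho
  have hmul : ∀ c z, Φ (o * c) z = Φ c z * Φ o z := fun c z =>
    map_rootOfUnity_mul hk0 (hΦ.continuous z) (fun c => hΦ.mem_unitary c z) (hΦ.map_one z) (hW z) c
  have hpow : ∀ (j : ℕ) z, Φ (o ^ j) z = Φ o z ^ j := by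
    intro j z
    induction j with
    | zero => rw [pow_zero, pow_zero, hΦ.map_one]
    | succ j ih => rw [pow_succ', hmul, ih, pow_succ]
  have hPk : ∀ z, Φ o z ^ k = 1 := fun z => by
    rw [← hpow, ho, rootOfUnity_pow_self hk0, hΦ.map_one]
  have hRl : ∀ z, (Φ o z ^ (k / l)) ^ l = 1 := fun z => by
    rw [← pow_mul, Nat.div_mul_cancel hl, hPk]
  have hRu : ∀ z, Φ o z ^ (k / l) ∈ unitary (Gl (Cn n)) := fun z =>
    pow_mem (hΦ.mem_unitary o z) _
  let p : M → ZMod l → Gl (Cn n) := fun z i => specProj (Φ o z ^ (k / l)) i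
  have hps : ∀ z i, star (p z i) = p z i := fun z i => star_specProj (hRu z) (hRl z) i
  have hpm : ∀ z i j, p z i * p z j = if i = j then p z j else 0 := fun z i j =>
    specProj_mul_specProj (hRl z) i j
  have hp1 : ∀ z, ∑ i, p z i = 1 := fun z => sum_specProj _
  have hpsm : ∀ i, ContMDiff 𝓘(ℝ, ℂ) 𝓘(ℝ, Gl (Cn n)) ∞ (fun z => p z i) := fun i =>
    (contDiff_specProj i (k / l)).contMDiff.comp (hΦ.contMDiff o)
  have hsum : ∀ z i, sumBundle Φ k l i z = LinearMap.range (p z i).toLinearMap := fun z i =>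
    iSup_ker_eq_range_specProj hk0 hl (hPk z) i
  let z₀ : M := Classical.arbitrary M
  have hrank : ∀ z i, Module.finrank ℂ (LinearMap.range (p z i).toLinearMap)
      = Module.finrank ℂ (LinearMap.range (p z₀ i).toLinearMap) := fun z i =>
    finrank_range_eq_of_continuous (hpsm i).continuous (fun z => by rw [hpm, if_pos rfl]) z z₀
  let φ : M → Flag (Cn n) l (fun i => Module.finrank ℂ (LinearMap.range (p z₀ i).toLinearMap)) :=
    fun z => flagOfProj (p z) (hps z) (hpm z) (hp1 z) (hrank z)
  have hproj : ∀ z i, (φ z).proj i = p z i := fun z i => proj_flagOfProj _ _ _ _ _ i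
  have hφ : IsSmooth φ := fun i => by
    simp_rw [hproj]
    exact hpsm i
  have hconn : ∀ e ∈ IsManifold.maximalAtlas 𝓘(ℂ) ω M, ∃ A B, HasShiftConnection φ e A B := by
    intro e he
    obtain ⟨A, B, hX, hY, hdiv, hA, hB, hder⟩ := hΦ.exists_connection hmul he
    -- Passing from P to R = P^{k/l} raises the eigenvalue ω_k of the shift to ω_l, so A shifts by 1
    -- modulo l whatever the divisor l.
    have ho1 : (o : ℂ) ^ (k / l) = ZMod.stdAddChar (1 : ZMod l) := by
      rw [← Nat.cast_one, stdAddChar_natCast, pow_one, ← rootOfUnity_pow_div hk0 hl,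
        Circle.coe_pow]
    refine ⟨A, B, hX, hY, hdiv, fun w hw i => ?_, fun w hw i => ?_, fun w hw i => ?_⟩
    · rw [hproj, hproj]
      exact specProj_mul_of_mul_eq (by rw [← ho1]; exact pow_mul_eq_smul (hA w hw) _) i
    · rw [hproj, hproj]
      refine specProj_mul_of_mul_eq ?_ i
      rw [AddChar.map_neg_eq_inv, ← ho1, ← inv_pow]
      exact pow_mul_eq_smul (hB w hw) _
    · simp_rw [hproj]
      exact ((hder w hw).pow _).specProj i
  exact ⟨_, φ, fun z i => (hsum z i).symm, fun z i => by rw [hsum, hrank],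
    isPrimitive_of_hasShiftConnection hφ hconn, isHarmonic_of_hasShiftConnection hφ hconn⟩
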